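/- Let $M$ be a smooth Hausdorff manifold of dimension $2n+1$ ($n\ge 1$) with a smooth Riemannian metric $g$, Levi-Civita connection $\nabla$ and curvature $R_{X,Y}Z=\nabla_X\nabla_YZ-\nabla_Y\nabla_XZ-\nabla_{[X,Y]}Z$. Let $(\varphi,Q,\xi,\eta,g)$ be a weak nearly Sasakian structure on $M$: $\varphi,Q$ are smooth $(1,1)$-tensors with $Q$ nonsingular, $\xi$ is a smooth vector field and $\eta$ a smooth 1-form such that $$\varphi^2=-Q+\eta\otimes\xi,\quad \eta(\xi)=1,\quad Q\xi=\xi,\quad \varphi(\ker\eta)\subset\ker\eta,\quad g(\varphi X,\varphi Y)=g(X,QY)-\eta(X)\eta(Y),$$ $$(\nabla_Y\varphi)Z+(\nabla_Z\varphi)Y=2g(Y,Z)\,\xi-\eta(Z)Y-\eta(Y)Z .$$ Put $\widetilde Q=Q-\mathrm{id}$ and $h=\nabla\xi+\varphi$ (that is, $hX=\nabla_X\xi+\varphi X$). Assume that $$(\nabla_\xi\widetilde Q)Y=0\ \ (Y\in\ker\eta),\qquad R_{\widetilde QX,Y}Z\in\ker\eta\ \ (X\in TM,\ Y,Z\in\ker\eta).$$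 Then for all smooth vector fields $X,Y,Z$ on $M$: - $R_{\xi,X}Y=-(\nabla_X(h-\varphi))Y$; - $(\nabla_X(h-\varphi))Y=g((h-\varphi)^2X,Y)\,\xi-\eta(Y)\,(h-\varphi)^2X$; - $\mathrm{Ric}(\xi,Z)=-\eta(Z)\,\bigl(\mathrm{tr}(h^2+\widetilde Q)-2n\bigr)$, where $\mathrm{Ric}(X,Y)=\sum_i g(R_{E_i,X}Y,E_i)$ for an orthonormal frame $(E_i)$. In particular, $\mathrm{tr}(h^2+\widetilde Q)$ and $\mathrm{Ric}(\xi,\xi)$ are constant on each connected component of $M$ (so constant if $M$ is connected), $\mathrm{Ric}(\xi,\xi)\ge 0$, and $\nabla_\xi h=\nabla_\xi\varphi=\varphi h+\widetilde Q$. -/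

import Mathlib

open Bundle Manifold
open scoped ContDiff

noncomputable section

section

variable {E : Type*} [NormedAddCommGroup E] [NormedSpace ℝ E]
  {H : Type*} [TopologicalSpace H] {I : ModelWithCorners ℝ E H}
  {M : Type*} [TopologicalSpace M] [ChartedSpace H M] [IsManifold I ∞ M]

/-- A smooth vector field on `M`. -/
def IsSmoothField (X : Π x : M, TangentSpace I x) : Prop :=
  ContMDiff I (I.prod 𝓘(ℝ, E)) ∞ (fun x ↦ TotalSpace.mk' E x (X x))

/-- A smooth 1-form on `M`. -/
def IsSmoothForm (η : Π x : M, TangentSpace I x →L[ℝ] ℝ) : Prop :=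
  ContMDiff I (I.prod 𝓘(ℝ, E →L[ℝ] ℝ)) ∞
    (fun x ↦ TotalSpace.mk' (E →L[ℝ] ℝ)
      (E := fun x : M ↦ TangentSpace I x →L[ℝ] Bundle.Trivial M ℝ x) x (η x))

/-- A smooth (1,1)-tensor field on `M`. -/
def IsSmoothEndo (A : Π x : M, TangentSpace I x →L[ℝ] TangentSpace I x) : Prop :=
  ContMDiff I (I.prod 𝓘(ℝ, E →L[ℝ] E)) ∞
    (fun x ↦ TotalSpace.mk' (E →L[ℝ] E)
      (E := fun x : M ↦ TangentSpace I x →L[ℝ] TangentSpace I x) x (A x))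

/-- `∇_X Y` for a connection on the tangent bundle. -/
def nabla (D : CovariantDerivative I E (TangentSpace I : M → Type _))
    (X Y : Π x : M, TangentSpace I x) (x : M) : TangentSpace I x :=
  D Y x (X x)

/-- `(∇_X A) Y = ∇_X (A Y) - A (∇_X Y)` for a (1,1)-tensor field `A`. -/
def nablaEndo (D : CovariantDerivative I E (TangentSpace I : M → Type _))
    (X : Π x : M, TangentSpace I x) (A : Π x : M, TangentSpace I x →L[ℝ] TangentSpace I x)
    (Y : Π x : M, TangentSpace I x) (x : M) : TangentSpace I x :=
  nabla D X (fun y ↦ A y (Y y)) x - A x (nabla D X Y x)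

/-- The curvature `R_{X,Y} Z = ∇_X ∇_Y Z - ∇_Y ∇_X Z - ∇_{[X,Y]} Z`. -/
def curvature (D : CovariantDerivative I E (TangentSpace I : M → Type _))
    (X Y Z : Π x : M, TangentSpace I x) (x : M) : TangentSpace I x :=
  nabla D X (nabla D Y Z) x - nabla D Y (nabla D X Z) x
    - nabla D (VectorField.mlieBracket I X Y) Z x

/-- `Q̃ = Q - id`. -/
def tildeQ (Q : Π x : M, TangentSpace I x →L[ℝ] TangentSpace I x) (x : M) :
    TangentSpace I x →L[ℝ] TangentSpace I x :=
  Q x - ContinuousLinearMap.id ℝ (TangentSpace I x)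

/-- `h = ∇ξ + φ`, that is `h X = ∇_X ξ + φ X`. -/
def tensorH (D : CovariantDerivative I E (TangentSpace I : M → Type _))
    (φ : Π x : M, TangentSpace I x →L[ℝ] TangentSpace I x)
    (ξ : Π x : M, TangentSpace I x) (x : M) : TangentSpace I x →L[ℝ] TangentSpace I x :=
  D ξ x + φ x

/-- The trace of an endomorphism of a tangent space. -/
def trEndo {x : M} (A : TangentSpace I x →L[ℝ] TangentSpace I x) : ℝ :=
  LinearMap.trace ℝ (TangentSpace I x) (A : TangentSpace I x →ₗ[ℝ] TangentSpace I x)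

variable [FiniteDimensional ℝ E] [RiemannianBundle (fun x : M ↦ TangentSpace I x)]

/-- `Ric(Y, Z) = ∑ i, g(R_{E_i, Y} Z, E_i)`, where `E_i` is an orthonormal basis of the tangent
space at `x`, extended to vector fields that are smooth near `x`. -/
def ricci (D : CovariantDerivative I E (TangentSpace I : M → Type _))
    (Y Z : Π x : M, TangentSpace I x) (x : M) : ℝ :=
  letI : FiniteDimensional ℝ (TangentSpace I x) := inferInstanceAs (FiniteDimensional ℝ E)
  ∑ i, inner ℝ
    (curvature D (FiberBundle.extend E (stdOrthonormalBasis ℝ (TangentSpace I x) i)) Y Z x)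
    (stdOrthonormalBasis ℝ (TangentSpace I x) i)

variable [IsContMDiffRiemannianBundle I ∞ E (fun x : M ↦ TangentSpace I x)]

/-- `D` is the Levi-Civita connection of the Riemannian metric: the smooth, metric, torsion-free
connection on the tangent bundle (these properties determine
`D` on differentiable vector fields). -/
structure IsLeviCivita (D : CovariantDerivative I E (TangentSpace I : M → Type _)) : Prop where
  smooth : D.ContMDiffCovariantDerivative ∞
  metric : ∀ (x : M) (v : TangentSpace I x) (Y Z : Π x : M, TangentSpace I x),
    MDifferentiableAt I (I.prod 𝓘(ℝ, E)) (fun y ↦ TotalSpace.mk' E y (Y y)) x →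
    MDifferentiableAt I (I.prod 𝓘(ℝ, E)) (fun y ↦ TotalSpace.mk' E y (Z y)) x →
    mfderiv I 𝓘(ℝ, ℝ) (fun y ↦ (inner ℝ (Y y) (Z y) : ℝ)) x v =
      (inner ℝ (D Y x v) (Z x) + inner ℝ (Y x) (D Z x v) : ℝ)
  torsion_free : D.torsion = 0

/-- A weak almost contact metric structure `(φ, Q, ξ, η, g)`, with `g` the Riemannian metric of
`M`; `ker η` is required to be `φ`-invariant. -/
structure IsWeakAlmostContactMetric (φ Q : Π x : M, TangentSpace I x →L[ℝ] TangentSpace I x)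
    (ξ : Π x : M, TangentSpace I x) (η : Π x : M, TangentSpace I x →L[ℝ] ℝ) : Prop where
  smooth_φ : IsSmoothEndo φ
  smooth_Q : IsSmoothEndo Q
  smooth_ξ : IsSmoothField ξ
  smooth_η : IsSmoothForm η
  nonsingular : ∀ x, Function.Bijective (Q x)
  sq_φ : ∀ (x : M) (u : TangentSpace I x), φ x (φ x u) = -(Q x u) + η x u • ξ x
  η_ξ : ∀ x, η x (ξ x) = 1
  Q_ξ : ∀ x, Q x (ξ x) = ξ x
  invariant : ∀ (x : M) (u : TangentSpace I x), η x u = 0 → η x (φ x u) = 0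
  compatible : ∀ (x : M) (u v : TangentSpace I x),
    inner ℝ (φ x u) (φ x v) = inner ℝ u (Q x v) - η x u * η x v

/-- A weak nearly Sasakian structure: a weak almost contact metric structure with
`(∇_Y φ) Z + (∇_Z φ) Y = 2 g(Y, Z) ξ - η(Z) Y - η(Y) Z`, where `∇ = D`. -/
structure IsWeakNearlySasakian (D : CovariantDerivative I E (TangentSpace I : M → Type _))
    (φ Q : Π x : M, TangentSpace I x →L[ℝ] TangentSpace I x)
    (ξ : Π x : M, TangentSpace I x) (η : Π x : M, TangentSpace I x →L[ℝ] ℝ) : Prop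
    extends IsWeakAlmostContactMetric φ Q ξ η where
  nearly : ∀ Y Z : Π x : M, TangentSpace I x, IsSmoothField Y → IsSmoothField Z → ∀ x,
    nablaEndo D Y φ Z x + nablaEndo D Z φ Y x =
      (2 * inner ℝ (Y x) (Z x) : ℝ) • ξ x - η x (Z x) • Y x - η x (Y x) • Z x

end

end

/-! Write A = ∇ξ. Everything follows from one formula, (∇_X A)Y = g(A²X, Y) ξ − η(Y) A²X
(`nablaEndo_D_ξ`).

Putting ξ into the nearly Sasakian identity expresses ∇_ξ φ through φA, and gives Aξ = 0. Hence ∇_ξ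
Q̃ = 0 on ker η improves to ∇_ξ Q = 0, so differentiating φ² = −Q + η ⊗ ξ along ξ makes ∇_ξ φ
anticommute with φ. This gives Aφ + φA = 2(id − η ⊗ ξ), AQ = QA and the skewness of A: ξ is Killing
(`inner_D_ξ`). The Killing identity then identifies R_{ξ,X}Y with −(∇_X A)Y.

Differentiating the nearly Sasakian identity once more prescribes the symmetric part of ∇²φ, while
the Ricci identity gives its alternation. Pair symmetry and the Bianchi identity then force φ,
acting as a derivation, to annihilate R (`curvature_φ_derivation`). Since φξ = 0, it also
annihilates c(u, v, w) = g((∇_u A)v, w). The curvature assumption kills Q̃ in the slots of c, so on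
ker η the square φ² acts as −1 in each slot. A sum of three numbers ±i is never zero, hence c = 0 on
ker η. The components along ξ are read off from Aξ = 0 and skewness.

Contracting the formula gives Ric(ξ, ·) = −tr(A²) η, and tr(h² + Q̃) = tr(A²) + 2n. By the formula,
∇_X(A²) is a sum of two traceless rank-one maps, so tr(A²) is locally constant; it is nonpositive
because A is skew. -/

set_option linter.unusedSectionVars false

/-! ### Smooth sections, extension of tangent vectors, and rules for connections. -/

section SmoothFields

variable {E : Type*} [NormedAddCommGroup E] [NormedSpace ℝ E]
  {H : Type*} [TopologicalSpace H] {I : ModelWithCorners ℝ E H}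
  {M : Type*} [TopologicalSpace M] [ChartedSpace H M] [IsManifold I ∞ M]
  {X Y Z : Π x : M, TangentSpace I x}

theorem IsSmoothField.mdifferentiableAt (hX : IsSmoothField X) (x : M) :
    MDifferentiableAt I (I.prod 𝓘(ℝ, E)) (fun y ↦ TotalSpace.mk' E y (X y)) x :=
  (ContMDiff.contMDiffAt hX).mdifferentiableAt (by simp)

theorem IsSmoothField.add (hX : IsSmoothField X) (hY : IsSmoothField Y) :
    IsSmoothField (X + Y) :=
  ContMDiff.add_section hX hY

theorem IsSmoothField.neg (hX : IsSmoothField X) : IsSmoothField (-X) :=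
  ContMDiff.neg_section hX

theorem IsSmoothField.sub (hX : IsSmoothField X) (hY : IsSmoothField Y) :
    IsSmoothField (X - Y) :=
  ContMDiff.sub_section hX hY

theorem IsSmoothField.smul {f : M → ℝ} (hf : ContMDiff I 𝓘(ℝ, ℝ) ∞ f) (hX : IsSmoothField X) :
    IsSmoothField (f • X) :=
  ContMDiff.smul_section hf hX

theorem IsSmoothEndo.apply {A : Π x : M, TangentSpace I x →L[ℝ] TangentSpace I x}
    (hA : IsSmoothEndo A) (hX : IsSmoothField X) : IsSmoothField (fun x ↦ A x (X x)) :=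
  ContMDiff.clm_bundle_apply (F₁ := E) (F₂ := E) (E₁ := fun x : M ↦ TangentSpace I x)
    (E₂ := fun x : M ↦ TangentSpace I x) (b := fun x ↦ x) hA hX

theorem IsSmoothEndo.mdifferentiableAt_apply
    {A : Π x : M, TangentSpace I x →L[ℝ] TangentSpace I x}
    (hA : IsSmoothEndo A) {x : M}
    (hX : MDifferentiableAt I (I.prod 𝓘(ℝ, E)) (fun y ↦ TotalSpace.mk' E y (X y)) x) :
    MDifferentiableAt I (I.prod 𝓘(ℝ, E)) (fun y ↦ TotalSpace.mk' E y (A y (X y))) x :=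
  MDifferentiableAt.clm_bundle_apply (F₁ := E) (F₂ := E) (E₁ := fun x : M ↦ TangentSpace I x)
    (E₂ := fun x : M ↦ TangentSpace I x) (b := fun x ↦ x)
    ((ContMDiff.contMDiffAt hA).mdifferentiableAt (by simp)) hX

theorem IsSmoothForm.apply {η : Π x : M, TangentSpace I x →L[ℝ] ℝ}
    (hη : IsSmoothForm η) (hX : IsSmoothField X) :
    ContMDiff I 𝓘(ℝ, ℝ) ∞ (fun x ↦ η x (X x)) := by
  have h : ContMDiff I (I.prod 𝓘(ℝ, ℝ)) ∞
      (fun x ↦ TotalSpace.mk' ℝ (E := Bundle.Trivial M ℝ) x (η x (X x))) :=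
    ContMDiff.clm_bundle_apply (F₁ := E) (F₂ := ℝ) (E₁ := fun x : M ↦ TangentSpace I x)
      (E₂ := Bundle.Trivial M ℝ) (b := fun x ↦ x) hη hX
  intro x
  have := (Bundle.contMDiffAt_section x).1 (h x)
  simpa using this

/-- Every tangent vector extends to a global smooth vector field which near the base point
agrees with `FiberBundle.extend`. -/
theorem exists_isSmoothField_eventuallyEq [FiniteDimensional ℝ E] [T2Space M] {x : M}
    (v : TangentSpace I x) :
    ∃ X : Π y : M, TangentSpace I y, IsSmoothField X ∧ X x = v ∧
      ∀ᶠ y in nhds x, X y = FiberBundle.extend (E := fun x : M ↦ TangentSpace I x) E v y := by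
  obtain ⟨s, hs, hsm⟩ := FiberBundle.exists_contMDiffOn_extend (k := ∞) I E v
  -- The bump function is supported where the local extension is smooth, so the product is globally
  -- smooth.
  obtain ⟨f, hf, -⟩ := (SmoothBumpFunction.nhds_basis_support (I := I)
    (interior_mem_nhds.2 hs)).mem_iff.1 Filter.univ_mem
  have hone : ∀ᶠ y in nhds x, (⇑f • FiberBundle.extend (E := fun x : M ↦ TangentSpace I x) E v) y =
      FiberBundle.extend (E := fun x : M ↦ TangentSpace I x) E v y := by
    filter_upwards [f.eventuallyEq_one] with y hy
    simp [hy]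
  refine ⟨⇑f • FiberBundle.extend (E := fun x : M ↦ TangentSpace I x) E v, ?_, by simp, hone⟩
  exact ContMDiffOn.smul_section_of_tsupport f.contMDiff.contMDiffOn isOpen_interior hf
    (hsm.mono interior_subset)

theorem exists_isSmoothField_apply_eq [FiniteDimensional ℝ E] [T2Space M] {x : M}
    (v : TangentSpace I x) : ∃ X : Π y : M, TangentSpace I y, IsSmoothField X ∧ X x = v :=
  let ⟨X, h, h', _⟩ := exists_isSmoothField_eventuallyEq v
  ⟨X, h, h'⟩

section Connection

variable {D : CovariantDerivative I E (TangentSpace I : M → Type _)}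

theorem nabla_add (hY : IsSmoothField Y) (hZ : IsSmoothField Z) :
    nabla D X (Y + Z) = nabla D X Y + nabla D X Z := by
  ext x
  simp only [nabla, Pi.add_apply]
  rw [D.isCovariantDerivativeOnUniv.add (hY.mdifferentiableAt x) (hZ.mdifferentiableAt x)]
  rfl

theorem nabla_smul {f : M → ℝ} (hf : ContMDiff I 𝓘(ℝ, ℝ) ∞ f) (hY : IsSmoothField Y) (x : M) :
    nabla D X (f • Y) x = f x • nabla D X Y x + mvfderiv I f x (X x) • Y x := by
  simp only [nabla]
  rw [D.isCovariantDerivativeOnUniv.leibniz (hY.mdifferentiableAt x)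
    (hf.contMDiffAt.mdifferentiableAt (by simp))]
  simp

theorem nabla_neg (hY : IsSmoothField Y) : nabla D X (-Y) = -nabla D X Y := by
  ext x
  have h := D.isCovariantDerivativeOnUniv.smul_const (-1) (hY.mdifferentiableAt x)
  simp only [neg_smul, one_smul] at h
  simp [nabla, h]

theorem nabla_sub (hY : IsSmoothField Y) (hZ : IsSmoothField Z) :
    nabla D X (Y - Z) = nabla D X Y - nabla D X Z := by
  rw [sub_eq_add_neg, nabla_add hY hZ.neg, nabla_neg hZ, sub_eq_add_neg]

/-- The derivative terms of the Leibniz rule cancel, so the expression is tensorial in `Y`. Formulas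
proved for global smooth fields thus pass to fields differentiable only at `x`. -/
theorem IsSmoothEndo.nablaEndo_congr [FiniteDimensional ℝ E]
    {A : Π x : M, TangentSpace I x →L[ℝ] TangentSpace I x} (hA : IsSmoothEndo A) {x : M}
    {Y' : Π x : M, TangentSpace I x}
    (hY : MDifferentiableAt I (I.prod 𝓘(ℝ, E)) (fun y ↦ TotalSpace.mk' E y (Y y)) x)
    (hY' : MDifferentiableAt I (I.prod 𝓘(ℝ, E)) (fun y ↦ TotalSpace.mk' E y (Y' y)) x)
    (h : Y x = Y' x) : nablaEndo D X A Y x = nablaEndo D X A Y' x := by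
  refine TensorialAt.pointwise (I := I) (F := E) (V := fun x : M ↦ TangentSpace I x)
    (Φ := fun Y ↦ nablaEndo D X A Y x) ⟨?_, ?_⟩ hY hY' h
  · intro f σ hf hσ
    have e : (fun y ↦ A y ((f • σ) y)) = f • (fun y ↦ A y (σ y)) := by ext y; simp
    simp only [nablaEndo, nabla, e]
    rw [D.isCovariantDerivativeOnUniv.leibniz hσ hf,
      D.isCovariantDerivativeOnUniv.leibniz (hA.mdifferentiableAt_apply hσ) hf]
    simp [smul_sub]
  · intro σ σ' hσ hσ'
    have e : (fun y ↦ A y ((σ + σ') y)) = (fun y ↦ A y (σ y)) + (fun y ↦ A y (σ' y)) := by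
      ext y; simp
    simp only [nablaEndo, nabla, e]
    rw [D.isCovariantDerivativeOnUniv.add hσ hσ',
      D.isCovariantDerivativeOnUniv.add (hA.mdifferentiableAt_apply hσ)
        (hA.mdifferentiableAt_apply hσ')]
    simp
    abel

theorem nablaEndo_congr_left {X' : Π x : M, TangentSpace I x}
    {A : Π x : M, TangentSpace I x →L[ℝ] TangentSpace I x} {x : M} (h : X x = X' x) :
    nablaEndo D X A Y x = nablaEndo D X' A Y x := by
  simp [nablaEndo, nabla, h]

end Connection

end SmoothFields

/-! ### Symmetries of the Riemann curvature. -/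

section LeviCivita

variable {E : Type*} [NormedAddCommGroup E] [NormedSpace ℝ E]
  {H : Type*} [TopologicalSpace H] {I : ModelWithCorners ℝ E H}
  {M : Type*} [TopologicalSpace M] [ChartedSpace H M] [IsManifold I ∞ M]
  [FiniteDimensional ℝ E] [RiemannianBundle (fun x : M ↦ TangentSpace I x)]
  [IsContMDiffRiemannianBundle I ∞ E (fun x : M ↦ TangentSpace I x)]
  {D : CovariantDerivative I E (TangentSpace I : M → Type _)}
  {W X Y Z : Π x : M, TangentSpace I x}

theorem IsSmoothField.inner (hX : IsSmoothField X) (hY : IsSmoothField Y) :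
    ContMDiff I 𝓘(ℝ, ℝ) ∞ (fun x ↦ (inner ℝ (X x) (Y x) : ℝ)) :=
  ContMDiff.inner_bundle (b := fun x : M ↦ x) (E := fun x : M ↦ TangentSpace I x) hX hY

namespace IsLeviCivita

theorem isSmoothEndo (hD : IsLeviCivita D) (hY : IsSmoothField Y) : IsSmoothEndo (D Y) := by
  have h := hD.smooth.contMDiff.contMDiff (σ := Y) (hY.contMDiffOn)
  exact contMDiffOn_univ.1 h

theorem isSmoothField_nabla (hD : IsLeviCivita D) (hX : IsSmoothField X) (hY : IsSmoothField Y) :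
    IsSmoothField (nabla D X Y) :=
  (hD.isSmoothEndo hY).apply hX

theorem mvfderiv_inner (hD : IsLeviCivita D) (hY : IsSmoothField Y) (hZ : IsSmoothField Z)
    (x : M) : mvfderiv I (fun y ↦ (inner ℝ (Y y) (Z y) : ℝ)) x (X x) =
      inner ℝ (nabla D X Y x) (Z x) + inner ℝ (Y x) (nabla D X Z x) :=
  hD.metric x (X x) Y Z (hY.mdifferentiableAt x) (hZ.mdifferentiableAt x)

theorem mlieBracket_eq (hD : IsLeviCivita D) (hX : IsSmoothField X) (hY : IsSmoothField Y) :
    VectorField.mlieBracket I X Y = nabla D X Y - nabla D Y X := by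
  have : IsManifold I 2 M := .of_le (n := ∞) ENat.LEInfty.out
  ext x
  exact (D.torsion_eq_zero_iff.1 hD.torsion_free (hX.mdifferentiableAt x)
    (hY.mdifferentiableAt x)).symm

theorem curvature_eq (hD : IsLeviCivita D) (hX : IsSmoothField X) (hY : IsSmoothField Y)
    (x : M) : curvature D X Y Z x =
      nabla D X (nabla D Y Z) x - nabla D Y (nabla D X Z) x
        - (nabla D (nabla D X Y) Z x - nabla D (nabla D Y X) Z x) := by
  rw [curvature, hD.mlieBracket_eq hX hY]
  simp [nabla]

theorem jacobi (hX : IsSmoothField X) (hY : IsSmoothField Y) (hZ : IsSmoothField Z) (x : M) :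
    VectorField.mlieBracket I X (VectorField.mlieBracket I Y Z) x =
      VectorField.mlieBracket I (VectorField.mlieBracket I X Y) Z x +
        VectorField.mlieBracket I Y (VectorField.mlieBracket I X Z) x := by
  have : IsManifold I (minSmoothness ℝ 3) M := by
    simp only [minSmoothness_of_isRCLikeNormedField]
    exact .of_le (n := ∞) ENat.LEInfty.out
  have h {V : Π x : M, TangentSpace I x} (hV : IsSmoothField V) :
      ContMDiffAt I (I.prod 𝓘(ℝ, E)) (minSmoothness ℝ 2)
        (fun y ↦ TotalSpace.mk' E y (V y)) x := by
    simp only [minSmoothness_of_isRCLikeNormedField]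
    exact (ContMDiff.contMDiffAt hV).of_le ENat.LEInfty.out
  exact VectorField.leibniz_identity_mlieBracket_apply (h hX) (h hY) (h hZ)

/-- Torsion-freeness turns brackets into differences of covariant derivatives; the Jacobi identity
then becomes this one. -/
theorem bianchi (hD : IsLeviCivita D) (hX : IsSmoothField X) (hY : IsSmoothField Y)
    (hZ : IsSmoothField Z) (x : M) :
    curvature D X Y Z x + curvature D Y Z X x + curvature D Z X Y x = 0 := by
  have n {X Y} (hX : IsSmoothField X) (hY : IsSmoothField Y) := hD.isSmoothField_nabla hX hY
  have j := jacobi hX hY hZ x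
  rw [hD.mlieBracket_eq hY hZ, hD.mlieBracket_eq hX hZ, hD.mlieBracket_eq hX hY,
    hD.mlieBracket_eq hX ((n hY hZ).sub (n hZ hY)),
    hD.mlieBracket_eq ((n hX hY).sub (n hY hX)) hZ,
    hD.mlieBracket_eq hY ((n hX hZ).sub (n hZ hX)),
    nabla_sub (n hY hZ) (n hZ hY), nabla_sub (n hX hY) (n hY hX),
    nabla_sub (n hX hZ) (n hZ hX)] at j
  rw [hD.curvature_eq hX hY, hD.curvature_eq hY hZ, hD.curvature_eq hZ hX]
  simp only [nabla, Pi.sub_apply, map_sub] at j ⊢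
  rw [← sub_eq_zero] at j
  rw [← j]
  abel

/-- The Lie bracket acts on functions as the commutator of derivations. -/
theorem mvfderiv_mlieBracket {f g h : M → ℝ}
    (hf : ContMDiff I 𝓘(ℝ, ℝ) ∞ f) (hX : IsSmoothField X) (hY : IsSmoothField Y)
    (hg : ContMDiff I 𝓘(ℝ, ℝ) ∞ g) (hh : ContMDiff I 𝓘(ℝ, ℝ) ∞ h)
    (hgf : ∀ x, g x = mvfderiv I f x (X x)) (hhf : ∀ x, h x = mvfderiv I f x (Y x))
    (hD : IsLeviCivita D) [T2Space M] (x : M) :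
    mvfderiv I h x (X x) - mvfderiv I g x (Y x) =
      mvfderiv I f x (VectorField.mlieBracket I X Y x) := by
  have : IsManifold I 2 M := .of_le (n := ∞) ENat.LEInfty.out
  -- The Jacobi identity for `X`, `Y`, `f • W`, minus `f` times the one for `X`, `Y`, `W`, leaves
  -- the desired scalar times `W`. It suffices that `W x ≠ 0`; if the tangent space is zero, both
  -- sides vanish.
  by_cases hv : ∃ v : TangentSpace I x, v ≠ 0
  · obtain ⟨v, hv⟩ := hv
    obtain ⟨W, hW, rfl⟩ := exists_isSmoothField_apply_eq v
    have bs {V : Π x : M, TangentSpace I x} {k : M → ℝ} {U : Π x : M, TangentSpace I x}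
        (hk : ContMDiff I 𝓘(ℝ, ℝ) ∞ k) (hU : IsSmoothField U) (y : M) :
        VectorField.mlieBracket I V (k • U) y =
          mvfderiv I k y (V y) • U y + k y • VectorField.mlieBracket I V U y :=
      VectorField.mlieBracket_smul_right (hk.contMDiffAt.mdifferentiableAt (by simp))
        (hU.mdifferentiableAt y)
    have br {U V : Π x : M, TangentSpace I x} (hU : IsSmoothField U) (hV : IsSmoothField V) :
        IsSmoothField (VectorField.mlieBracket I U V) := by
      rw [hD.mlieBracket_eq hU hV]
      exact (hD.isSmoothField_nabla hU hV).sub (hD.isSmoothField_nabla hV hU)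
    have ba {V A B : Π x : M, TangentSpace I x}
        (hA : IsSmoothField A) (hB : IsSmoothField B) (y : M) :
        VectorField.mlieBracket I V (A + B) y =
          VectorField.mlieBracket I V A y + VectorField.mlieBracket I V B y :=
      VectorField.mlieBracket_add_right (hA.mdifferentiableAt y) (hB.mdifferentiableAt y)
    have e1 : VectorField.mlieBracket I X (f • W) = g • W + f • VectorField.mlieBracket I X W := by
      ext y
      simp [bs hf hW, hgf]
    have e2 : VectorField.mlieBracket I Y (f • W) = h • W + f • VectorField.mlieBracket I Y W := by
      ext y
      simp [bs hf hW, hhf]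
    have j := jacobi hX hY (hW.smul hf) x
    have j' := jacobi hX hY hW x
    rw [e1, e2, ba (hW.smul hh) ((br hY hW).smul hf), ba (hW.smul hg) ((br hX hW).smul hf),
      bs hh hW, bs hf (br hY hW), bs hf hW, bs hg hW, bs hf (br hX hW), j',
      ← hgf, ← hhf] at j
    have : (mvfderiv I h x (X x) - mvfderiv I g x (Y x) -
      mvfderiv I f x (VectorField.mlieBracket I X Y x)) • W x = 0 := by
      rw [← sub_eq_zero] at j
      rw [← j]
      module
    rcases smul_eq_zero.1 this with h | h
    · linarith
    · exact absurd h hv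
  · push Not at hv
    simp [hv]

variable [T2Space M]

/-- Metric compatibility, used twice in [X, Y]f = XYf − YXf for f = g(Z, W). -/
theorem inner_curvature_swap (hD : IsLeviCivita D) (hX : IsSmoothField X) (hY : IsSmoothField Y)
    (hZ : IsSmoothField Z) (hW : IsSmoothField W) (x : M) :
    (inner ℝ (curvature D X Y Z x) (W x) : ℝ) = -inner ℝ (curvature D X Y W x) (Z x) := by
  have n {X Y} (hX : IsSmoothField X) (hY : IsSmoothField Y) := hD.isSmoothField_nabla hX hY
  have k := mvfderiv_mlieBracket (hZ.inner hW) hX hY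
    (((n hX hZ).inner hW).add (hZ.inner (n hX hW)))
    (((n hY hZ).inner hW).add (hZ.inner (n hY hW)))
    (fun y ↦ (hD.mvfderiv_inner hZ hW y).symm) (fun y ↦ (hD.mvfderiv_inner hZ hW y).symm) hD x
  have md {A B : Π x : M, TangentSpace I x} (hA : IsSmoothField A) (hB : IsSmoothField B) :
      MDifferentiableAt I 𝓘(ℝ, ℝ) (fun y ↦ (inner ℝ (A y) (B y) : ℝ)) x :=
    (hA.inner hB).contMDiffAt.mdifferentiableAt (by simp)
  rw [mvfderiv_add (md (n hY hZ) hW) (md hZ (n hY hW)),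
    mvfderiv_add (md (n hX hZ) hW) (md hZ (n hX hW)),
    hD.mvfderiv_inner (X := VectorField.mlieBracket I X Y) hZ hW] at k
  simp only [_root_.add_apply, hD.mvfderiv_inner (n hY hZ) hW,
    hD.mvfderiv_inner (n hX hZ) hW, hD.mvfderiv_inner hZ (n hY hW),
    hD.mvfderiv_inner hZ (n hX hW)] at k
  rw [real_inner_comm (Z x) (curvature D X Y W x)]
  simp only [curvature, inner_sub_left, inner_sub_right]
  linarith

theorem curvature_swap (hD : IsLeviCivita D) (hX : IsSmoothField X) (hY : IsSmoothField Y)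
    (x : M) : curvature D X Y Z x = -curvature D Y X Z x := by
  rw [hD.curvature_eq hX hY, hD.curvature_eq hY hX]
  abel

theorem inner_curvature_pair_symm (hD : IsLeviCivita D) (hX : IsSmoothField X)
    (hY : IsSmoothField Y) (hZ : IsSmoothField Z) (hW : IsSmoothField W) (x : M) :
    (inner ℝ (curvature D X Y Z x) (W x) : ℝ) = inner ℝ (curvature D Z W X x) (Y x) := by
  have s {X Y Z W : Π x : M, TangentSpace I x} (hX : IsSmoothField X) (hY : IsSmoothField Y) (hZ : IsSmoothField Z)
      (hW : IsSmoothField W) := hD.inner_curvature_swap hX hY hZ hW x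
  have a {X Y Z W : Π x : M, TangentSpace I x} (hX : IsSmoothField X) (hY : IsSmoothField Y) :
      (inner ℝ (curvature D X Y Z x) (W x) : ℝ) = -inner ℝ (curvature D Y X Z x) (W x) := by
    rw [hD.curvature_swap hX hY, inner_neg_left]
  have b {X Y Z W : Π x : M, TangentSpace I x} (hX : IsSmoothField X) (hY : IsSmoothField Y) (hZ : IsSmoothField Z) :
      (inner ℝ (curvature D X Y Z x) (W x) : ℝ) + inner ℝ (curvature D Y Z X x) (W x)
        + inner ℝ (curvature D Z X Y x) (W x) = 0 := by
    rw [← inner_add_left, ← inner_add_left, hD.bianchi hX hY hZ, inner_zero_left]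
  -- The classical octahedron argument: four Bianchi identities combined with the two skew
  -- symmetries.
  linarith [b (W := W) hX hY hZ, b (W := X) hY hZ hW, b (W := Y) hZ hW hX, b (W := Z) hW hX hY,
    s hX hY hZ hW, s hY hZ hX hW, s hZ hX hY hW, s hY hZ hW hX, s hZ hW hY hX, s hW hY hZ hX,
    s hZ hW hX hY, s hW hX hZ hY, s hX hZ hW hY, s hW hX hY hZ, s hX hY hW hZ, s hY hW hX hZ,
    a (Z := W) (W := X) hY hZ, a (Z := Y) (W := X) hZ hW, a (Z := Z) (W := X) hW hY,
    a (Z := Y) (W := Z) hW hX, a (Z := W) (W := Y) hX hZ, a (Z := Y) (W := W) hX hZ,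
    a (Z := X) (W := Z) hY hW, a (Z := X) (W := W) hY hZ, a (Z := X) (W := Y) hZ hW,
    a (Z := Z) (W := Y) hW hX, a (Z := Z) (W := W) hX hY, a (Z := W) (W := Z) hX hY]

end IsLeviCivita

end LeviCivita

/-! ### Pointwise algebra of the structure, and ξ as a Killing field. -/

section NearlySasakian

variable {E : Type*} [NormedAddCommGroup E] [NormedSpace ℝ E]
  {H : Type*} [TopologicalSpace H] {I : ModelWithCorners ℝ E H}
  {M : Type*} [TopologicalSpace M] [ChartedSpace H M] [IsManifold I ∞ M]
  [FiniteDimensional ℝ E] [RiemannianBundle (fun x : M ↦ TangentSpace I x)]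
  [IsContMDiffRiemannianBundle I ∞ E (fun x : M ↦ TangentSpace I x)]
  {D : CovariantDerivative I E (TangentSpace I : M → Type _)}
  {φ Q : Π x : M, TangentSpace I x →L[ℝ] TangentSpace I x}
  {ξ : Π x : M, TangentSpace I x} {η : Π x : M, TangentSpace I x →L[ℝ] ℝ}

namespace IsWeakAlmostContactMetric

theorem φ_ξ (h : IsWeakAlmostContactMetric φ Q ξ η) (x : M) : φ x (ξ x) = 0 := by
  have h1 : φ x (φ x (ξ x)) = 0 := by rw [h.sq_φ, h.Q_ξ, h.η_ξ]; simp
  have h2 : η x (φ x (ξ x)) = 0 := by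
    -- The vector φξ − η(φξ)ξ lies in ker η, and since φ²ξ = 0 its image under φ has η-value
    -- −η(φξ)².
    simpa [h1] using h.invariant x (φ x (ξ x) - η x (φ x (ξ x)) • ξ x) (by simp [h.η_ξ])
  have h3 := h.sq_φ x (φ x (ξ x))
  rw [h1, map_zero, h2, zero_smul, add_zero, eq_comm, neg_eq_zero] at h3
  exact (h.nonsingular x).1 (by rw [h3, map_zero])

theorem η_φ (h : IsWeakAlmostContactMetric φ Q ξ η) (x : M) (u : TangentSpace I x) :
    η x (φ x u) = 0 := by
  have := h.invariant x (u - η x u • ξ x) (by simp [h.η_ξ])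
  simpa [h.φ_ξ] using this

theorem inner_Q (h : IsWeakAlmostContactMetric φ Q ξ η) (x : M) (u v : TangentSpace I x) :
    (inner ℝ (Q x u) v : ℝ) = inner ℝ u (Q x v) := by
  have h1 := h.compatible x u v
  have h2 := h.compatible x v u
  rw [real_inner_comm] at h2
  rw [real_inner_comm]
  linarith

theorem η_eq_inner (h : IsWeakAlmostContactMetric φ Q ξ η) (x : M) (u : TangentSpace I x) :
    η x u = inner ℝ (ξ x) u := by
  have h1 := h.compatible x (ξ x) u
  rw [h.φ_ξ, inner_zero_left, ← h.inner_Q, h.Q_ξ, h.η_ξ] at h1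
  linarith

theorem φ_Q (h : IsWeakAlmostContactMetric φ Q ξ η) (x : M) (u : TangentSpace I x) :
    φ x (Q x u) = Q x (φ x u) := by
  have h1 := h.sq_φ x (φ x u)
  rw [h.sq_φ x u, h.η_φ] at h1
  simpa [h.φ_ξ] using h1

theorem inner_φ (h : IsWeakAlmostContactMetric φ Q ξ η) (x : M) (u v : TangentSpace I x) :
    (inner ℝ (φ x u) v : ℝ) = -inner ℝ u (φ x v) := by
  -- With v = Qw, compatibility for u and φw produces φ²w = −Qw + η(w)ξ on the left, and the ξ term
  -- is orthogonal to φu.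
  obtain ⟨w, rfl⟩ := (h.nonsingular x).2 v
  have h1 := h.compatible x u (φ x w)
  rw [h.sq_φ, h.η_φ, inner_add_right, inner_neg_right, inner_smul_right, real_inner_comm (ξ x),
    ← h.η_eq_inner, h.η_φ] at h1
  rw [h.φ_Q]
  linarith

end IsWeakAlmostContactMetric

variable [T2Space M] {X Y Z : Π x : M, TangentSpace I x}

theorem IsLeviCivita.inner_nablaEndo_of_skew (hD : IsLeviCivita D)
    {A : Π x : M, TangentSpace I x →L[ℝ] TangentSpace I x} (hA : IsSmoothEndo A)
    (hs : ∀ (x : M) (u v : TangentSpace I x), (inner ℝ (A x u) v : ℝ) = -inner ℝ u (A x v))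
    (hY : IsSmoothField Y) (hZ : IsSmoothField Z) (x : M) :
    (inner ℝ (nablaEndo D X A Y x) (Z x) : ℝ) = -inner ℝ (Y x) (nablaEndo D X A Z x) := by
  have h1 := hD.mvfderiv_inner (X := X) (hA.apply hY) hZ x
  have h2 := hD.mvfderiv_inner (X := X) hY (hA.apply hZ) x
  have e : (fun y ↦ (inner ℝ (A y (Y y)) (Z y) : ℝ)) = -fun y ↦ inner ℝ (Y y) (A y (Z y)) := by
    ext y
    simp [hs]
  rw [e, mvfderiv_neg] at h1
  simp only [_root_.neg_apply] at h1
  rw [h2] at h1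
  simp only [nablaEndo, inner_sub_left, inner_sub_right, hs] at h1 ⊢
  linarith [hs x (Y x) (nabla D X Z x)]

namespace IsWeakNearlySasakian

/-- `∇_ξ φ` in terms of `∇ξ`. -/
theorem nablaEndo_ξ_φ (hS : IsWeakNearlySasakian D φ Q ξ η) (hY : IsSmoothField Y) (x : M) :
    nablaEndo D ξ φ Y x = φ x (D ξ x (Y x)) + η x (Y x) • ξ x - Y x := by
  have h := hS.nearly Y ξ hY hS.smooth_ξ x
  have e : nablaEndo D Y φ ξ x = -φ x (D ξ x (Y x)) := by
    have : (fun y ↦ φ y (ξ y)) = 0 := by ext y; exact hS.φ_ξ y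
    simp only [nablaEndo, this, nabla, D.zero]
    simp
  rw [e, hS.η_ξ, real_inner_comm, ← hS.η_eq_inner] at h
  rw [← sub_eq_zero] at h ⊢
  rw [← h]
  module

theorem η_D_ξ (hD : IsLeviCivita D) (hS : IsWeakNearlySasakian D φ Q ξ η) (x : M)
    (u : TangentSpace I x) : η x (D ξ x u) = 0 := by
  obtain ⟨U, hU, rfl⟩ := exists_isSmoothField_apply_eq u
  have h := hD.mvfderiv_inner (X := U) hS.smooth_ξ hS.smooth_ξ x
  have e : (fun y ↦ (inner ℝ (ξ y) (ξ y) : ℝ)) = fun _ ↦ 1 := by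
    ext y
    rw [← hS.η_eq_inner, hS.η_ξ]
  rw [e, mvfderiv_const, real_inner_comm, ← hS.η_eq_inner] at h
  simp only [nabla, _root_.zero_apply] at h
  linarith

/-- `ξ` is a geodesic vector field. -/
theorem D_ξ_ξ (hD : IsLeviCivita D) (hS : IsWeakNearlySasakian D φ Q ξ η) (x : M) :
    D ξ x (ξ x) = 0 := by
  have h1 := hS.nablaEndo_ξ_φ hS.smooth_ξ x
  have h2 := hS.nearly ξ ξ hS.smooth_ξ hS.smooth_ξ x
  rw [← hS.η_eq_inner, h1, hS.η_ξ] at h2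
  -- The nearly Sasakian identity at (ξ, ξ) says 2(∇_ξ φ)ξ = 0. So φ kills ∇_ξ ξ, and as ∇_ξ ξ lies
  -- in ker η, where φ² = −Q, it vanishes.
  have h3 : φ x (D ξ x (ξ x)) = 0 := by
    have : (2 : ℝ) • φ x (D ξ x (ξ x)) = 0 := by
      rw [← sub_eq_zero] at h2
      rw [← h2]
      module
    simpa using this
  have h4 := hS.sq_φ x (D ξ x (ξ x))
  rw [h3, map_zero, hS.η_D_ξ hD, zero_smul, add_zero, eq_comm, neg_eq_zero] at h4
  exact (hS.nonsingular x).1 (by rw [h4, map_zero])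

/-- Subtracting the ξ-component of `Y` reduces to ker η; that component contributes nothing because
Qξ = ξ and ∇_ξ ξ = 0. -/
theorem nablaEndo_ξ_Q (hD : IsLeviCivita D) (hS : IsWeakNearlySasakian D φ Q ξ η)
    (hQ : ∀ Y : Π x : M, TangentSpace I x, IsSmoothField Y →
      ∀ x, η x (Y x) = 0 → nablaEndo D ξ (tildeQ Q) Y x = 0)
    (hY : IsSmoothField Y) (x : M) : nablaEndo D ξ Q Y x = 0 := by
  have e {Z : Π x : M, TangentSpace I x} (hZ : IsSmoothField Z) : nablaEndo D ξ (tildeQ Q) Z x = nablaEndo D ξ Q Z x := by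
    have : (fun y ↦ tildeQ Q y (Z y)) = (fun y ↦ Q y (Z y)) - Z := by ext y; simp [tildeQ]
    simp only [nablaEndo, this, nabla_sub (hS.smooth_Q.apply hZ) hZ]
    simp [tildeQ]
  have sη := IsSmoothForm.apply hS.smooth_η hY
  have s1 := hS.smooth_ξ.smul sη
  have h1 := hQ (Y - (fun y ↦ η y (Y y)) • ξ) (hY.sub s1) x (by simp [hS.η_ξ])
  rw [e (hY.sub s1)] at h1
  have e2 : (fun y ↦ Q y ((Y - (fun y ↦ η y (Y y)) • ξ) y)) =
      (fun y ↦ Q y (Y y)) - (fun y ↦ η y (Y y)) • ξ := by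
    ext y
    simp [hS.Q_ξ]
  unfold nablaEndo at h1 ⊢
  rw [e2, nabla_sub (hS.smooth_Q.apply hY) s1, nabla_sub hY s1, Pi.sub_apply, Pi.sub_apply,
    nabla_smul sη hS.smooth_ξ, map_sub, map_add, map_smul, map_smul, hS.Q_ξ, nabla, nabla,
    hS.D_ξ_ξ hD] at h1
  simpa [nabla] using h1

/-- `∇_ξ φ` anticommutes with `φ`. -/
theorem nablaEndo_ξ_φ_anticomm (hD : IsLeviCivita D) (hS : IsWeakNearlySasakian D φ Q ξ η)
    (hQ : ∀ Y : Π x : M, TangentSpace I x, IsSmoothField Y → ∀ x, nablaEndo D ξ Q Y x = 0)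
    (hY : IsSmoothField Y) (x : M) :
    nablaEndo D ξ φ (fun y ↦ φ y (Y y)) x + φ x (nablaEndo D ξ φ Y x) = 0 := by
  have h := hQ Y hY x
  have sη := IsSmoothForm.apply hS.smooth_η hY
  have e : (fun y ↦ φ y (φ y (Y y))) = -(fun y ↦ Q y (Y y)) + (fun y ↦ η y (Y y)) • ξ := by
    ext y
    simp [hS.sq_φ]
  have e1 : mvfderiv I (fun y ↦ η y (Y y)) x (ξ x) = η x (nabla D ξ Y x) := by
    have := hD.mvfderiv_inner (X := ξ) hS.smooth_ξ hY x
    simp only [← hS.η_eq_inner] at this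
    rw [this]
    simp [nabla, hS.D_ξ_ξ hD]
  unfold nablaEndo at h ⊢
  rw [e, map_sub, hS.sq_φ, nabla_add (hS.smooth_Q.apply hY).neg (hS.smooth_ξ.smul sη),
    nabla_neg (hS.smooth_Q.apply hY), Pi.add_apply, Pi.neg_apply, nabla_smul sη hS.smooth_ξ, e1,
    sub_eq_zero.1 h]
  simp [nabla, hS.D_ξ_ξ hD]

/-- The anticommutation of ∇_ξ φ with φ, rewritten with ∇_ξ φ = φ∇ξ + η ⊗ ξ − id. -/
theorem φ_D_ξ_φ (hD : IsLeviCivita D) (hS : IsWeakNearlySasakian D φ Q ξ η)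
    (hQ : ∀ Y : Π x : M, TangentSpace I x, IsSmoothField Y → ∀ x, nablaEndo D ξ Q Y x = 0)
    (x : M) (u : TangentSpace I x) :
    φ x (D ξ x (φ x u)) = Q x (D ξ x u) + (2 : ℝ) • φ x u := by
  obtain ⟨U, hU, rfl⟩ := exists_isSmoothField_apply_eq u
  have h := hS.nablaEndo_ξ_φ_anticomm hD hQ hU x
  rw [hS.nablaEndo_ξ_φ hU, hS.nablaEndo_ξ_φ (hS.smooth_φ.apply hU)] at h
  simp only [hS.η_φ, map_sub, map_add, map_smul, hS.φ_ξ, hS.sq_φ, hS.η_D_ξ hD] at h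
  rw [← sub_eq_zero] at h ⊢
  rw [← h]
  module

/-- Apply φ to `φ_D_ξ_φ` and cancel the injective Q. -/
theorem D_ξ_φ (hD : IsLeviCivita D) (hS : IsWeakNearlySasakian D φ Q ξ η)
    (hQ : ∀ Y : Π x : M, TangentSpace I x, IsSmoothField Y → ∀ x, nablaEndo D ξ Q Y x = 0)
    (x : M) (u : TangentSpace I x) :
    D ξ x (φ x u) = -φ x (D ξ x u) + (2 : ℝ) • (u - η x u • ξ x) := by
  have h := congrArg (φ x) (hS.φ_D_ξ_φ hD hQ x u)
  rw [hS.sq_φ, hS.η_D_ξ hD, map_add, map_smul, hS.sq_φ, hS.φ_Q] at h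
  apply (hS.nonsingular x).1
  simp only [map_add, map_neg, map_sub, map_smul, hS.Q_ξ]
  rw [← sub_eq_zero] at h ⊢
  rw [← neg_eq_zero, ← h]
  module

/-- ∇ξ anticommutes with φ up to 2(id − η ⊗ ξ), and the two corrections cancel in passing φ², hence
in passing Q. -/
theorem D_ξ_Q (hD : IsLeviCivita D) (hS : IsWeakNearlySasakian D φ Q ξ η)
    (hQ : ∀ Y : Π x : M, TangentSpace I x, IsSmoothField Y → ∀ x, nablaEndo D ξ Q Y x = 0)
    (x : M) (u : TangentSpace I x) : D ξ x (Q x u) = Q x (D ξ x u) := by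
  have h1 : Q x u = -φ x (φ x u) + η x u • ξ x := by rw [hS.sq_φ]; module
  have h2 := hS.sq_φ x (D ξ x u)
  rw [hS.η_D_ξ hD] at h2
  rw [h1, map_add, map_neg, map_smul, hS.D_ξ_ξ hD, hS.D_ξ_φ hD hQ, hS.D_ξ_φ hD hQ, map_add,
    map_neg, h2, map_smul, map_sub, map_smul, hS.φ_ξ, hS.η_φ]
  module

/-- `ξ` is a Killing vector field. -/
theorem inner_D_ξ (hD : IsLeviCivita D) (hS : IsWeakNearlySasakian D φ Q ξ η)
    (hQ : ∀ Y : Π x : M, TangentSpace I x, IsSmoothField Y → ∀ x, nablaEndo D ξ Q Y x = 0)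
    (x : M) (u v : TangentSpace I x) :
    (inner ℝ (D ξ x u) v : ℝ) = -inner ℝ u (D ξ x v) := by
  -- Two anticommuting skew maps have a skew product, so φ∘∇_ξ φ = −Q∇ξ − φ is skew, and with it
  -- Q∇ξ. As Q is self-adjoint, onto and commutes with ∇ξ, the skewness passes to ∇ξ.
  obtain ⟨w, rfl⟩ := (hS.nonsingular x).2 v
  obtain ⟨U, hU, rfl⟩ := exists_isSmoothField_apply_eq u
  obtain ⟨W, hW, rfl⟩ := exists_isSmoothField_apply_eq w
  have h := hD.inner_nablaEndo_of_skew (X := ξ) hS.smooth_φ hS.inner_φ hU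
    (hS.smooth_φ.apply hW) x
  rw [eq_neg_of_add_eq_zero_left (hS.nablaEndo_ξ_φ_anticomm hD hQ hW x), inner_neg_right,
    hS.nablaEndo_ξ_φ hU, hS.nablaEndo_ξ_φ hW, ← neg_inj, ← hS.inner_φ] at h
  simp only [map_sub, map_add, map_smul, hS.φ_ξ, hS.sq_φ, hS.η_D_ξ hD, inner_add_right,
    inner_sub_right, inner_neg_right, inner_smul_right, inner_add_left,
    inner_sub_left, inner_neg_left, inner_smul_left] at h
  have h' := hS.inner_φ x (U x) (W x)
  rw [hS.D_ξ_Q hD hQ, ← hS.inner_Q]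
  simp only [inner_zero_left, inner_zero_right, map_zero, zero_mul, mul_zero] at h
  linarith

end IsWeakNearlySasakian

end NearlySasakian

/-! ### The two algebraic lemmas on derivations. -/

section Algebra

/-- An algebraic curvature tensor `R` for which `[R, f]` is the alternation of a tensor `T`
whose symmetric parts are prescribed is annihilated by the derivation induced by `f`. -/
theorem curvature_derivation_eq_zero {α : Type*} {f : α → α} {R T : α → α → α → α → ℝ}
    {g a : α → α → ℝ} (hg : ∀ X Y, g X Y = g Y X) (ha : ∀ X Y, a X Y = -a Y X)
    (hpair : ∀ W X Y Z, R W X Y Z = R Y Z W X)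
    (hbianchi : ∀ W X Y Z, R W X Y Z + R X Y W Z + R Y W X Z = 0)
    (halt : ∀ W X Y Z, T W X Y Z - T X W Y Z = R W X (f Y) Z + R W X Y (f Z))
    (hskew : ∀ W X Y Z, T W X Y Z = -T W X Z Y)
    (hsymm : ∀ W X Y Z, T W X Y Z + T W Y X Z =
      2 * g X Y * a W Z - a W X * g Y Z - a W Y * g X Z) (W X Y Z : α) :
    R (f W) X Y Z + R W (f X) Y Z + R W X (f Y) Z + R W X Y (f Z) = 0 := by
  -- The subtracted term is a particular solution of both `hskew` and `hsymm`, so `S` is alternating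
  -- in its last three arguments.
  obtain ⟨S, hS⟩ : ∃ S : α → α → α → α → ℝ,
      ∀ W X Y Z, T W X Y Z = S W X Y Z + (g X Y * a W Z - a W Y * g X Z) :=
    ⟨fun W X Y Z ↦ T W X Y Z - (g X Y * a W Z - a W Y * g X Z), fun _ _ _ _ ↦ by ring⟩
  have s1 W X Y Z : S W X Y Z = -S W X Z Y := by
    have := hskew W X Y Z
    rw [hS, hS] at this
    linear_combination this
  have s2 W X Y Z : S W X Y Z = -S W Y X Z := by
    have := hsymm W X Y Z
    rw [hS, hS, hg Y X] at this
    linear_combination this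
  -- Pair symmetry expresses the derivation by `halt` at (W, X, Y, Z) and (Y, Z, W, X); the terms in
  -- `g` and `a` cancel between the two.
  have key W X Y Z : R (f W) X Y Z + R W (f X) Y Z + R W X (f Y) Z + R W X Y (f Z) =
      S W X Y Z - S X W Y Z + S Y Z W X - S Z Y W X := by
    have h1 := halt W X Y Z
    have h2 := halt Y Z W X
    rw [hS, hS] at h1 h2
    rw [hpair (f W) X Y Z, hpair W (f X) Y Z]
    rw [hg Z W, hg Z X, hg Y W, hg Y X, ha Y X, ha Z W, ha Z X, ha Y W] at h2
    linear_combination -h1 - h2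
  -- The derived tensor inherits the Bianchi identity. As `S` is alternating, its expression in `S`
  -- is invariant under cycling W, X, Y, so the cyclic sum is three times it.
  have c : (S W X Y Z - S X W Y Z + S Y Z W X - S Z Y W X) +
      (S X Y W Z - S Y X W Z + S W Z X Y - S Z W X Y) +
      (S Y W X Z - S W Y X Z + S X Z Y W - S Z X Y W) = 0 := by
    rw [← key, ← key, ← key]
    linear_combination hbianchi (f W) X Y Z + hbianchi W (f X) Y Z + hbianchi W X (f Y) Z +
      hbianchi W X Y (f Z)
  rw [key]
  linarith [s2 W Z X Y, s1 W X Z Y, s2 W Y X Z, s2 X Y W Z, s2 X Z Y W, s1 X Y Z W,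
    s2 Y X W Z, s2 Y Z W X, s1 Y W Z X, s2 Z Y W X, s1 Z W Y X, s1 Z X Y W, s2 Z X W Y]

/-- A function of three variables annihilated by the derivation induced by `f` vanishes where
`f ∘ f` acts as `-1` in each variable. -/
theorem eq_zero_of_derivation_eq_zero {V : Type*} {p : V → Prop} {f : V → V}
    (hf : ∀ x, p x → p (f x)) {c : V → V → V → ℝ}
    (h : ∀ x y z, p x → p y → p z → c (f x) y z + c x (f y) z + c x y (f z) = 0)
    (h1 : ∀ x y z, p x → p y → p z → c (f (f x)) y z = -c x y z)
    (h2 : ∀ x y z, p x → p y → p z → c x (f (f y)) z = -c x y z)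
    (h3 : ∀ x y z, p x → p y → p z → c x y (f (f z)) = -c x y z)
    {x y z : V} (hx : p x) (hy : p y) (hz : p z) : c x y z = 0 := by
  -- Applying `h` with `f` inserted in each pair of slots shows that the three terms of `h` are
  -- equal; their sum is zero.
  have k x y z (hx : p x) (hy : p y) (hz : p z) : c x y (f z) = 0 := by
    have := h _ _ _ (hf x hx) (hf y hy) hz
    have := h _ _ _ (hf x hx) hy (hf z hz)
    have := h _ _ _ hx (hf y hy) (hf z hz)
    have := h _ _ _ hx hy hz
    simp only [h1, h2, h3, hf, hx, hy, hz] at *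
    linarith
  have := k x y (f z) hx hy (hf z hz)
  rw [h3 x y z hx hy hz] at this
  linarith

end Algebra

/-! ### Second covariant derivatives, the Killing identity, and φ acting on curvature. -/

section SecondDerivative

variable {E : Type*} [NormedAddCommGroup E] [NormedSpace ℝ E]
  {H : Type*} [TopologicalSpace H] {I : ModelWithCorners ℝ E H}
  {M : Type*} [TopologicalSpace M] [ChartedSpace H M] [IsManifold I ∞ M]

/-- The second covariant derivative `(∇²_{W,X} A) Y` of a (1,1)-tensor field `A`. -/
noncomputable def nablaNablaEndo (D : CovariantDerivative I E (TangentSpace I : M → Type _))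
    (W X : Π x : M, TangentSpace I x) (A : Π x : M, TangentSpace I x →L[ℝ] TangentSpace I x)
    (Y : Π x : M, TangentSpace I x) (x : M) : TangentSpace I x :=
  nabla D W (nablaEndo D X A Y) x - nablaEndo D (nabla D W X) A Y x
    - nablaEndo D X A (nabla D W Y) x

variable [FiniteDimensional ℝ E] [RiemannianBundle (fun x : M ↦ TangentSpace I x)]
  [IsContMDiffRiemannianBundle I ∞ E (fun x : M ↦ TangentSpace I x)]
  {D : CovariantDerivative I E (TangentSpace I : M → Type _)}
  {A : Π x : M, TangentSpace I x →L[ℝ] TangentSpace I x}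
  {W X Y Z : Π x : M, TangentSpace I x}

namespace IsLeviCivita

theorem nablaEndo_eq_sub : nablaEndo D X A Y =
    nabla D X (fun y ↦ A y (Y y)) - fun y ↦ A y (nabla D X Y y) := rfl

theorem isSmoothField_nablaEndo (hD : IsLeviCivita D) (hA : IsSmoothEndo A)
    (hX : IsSmoothField X) (hY : IsSmoothField Y) : IsSmoothField (nablaEndo D X A Y) :=
  (hD.isSmoothField_nabla hX (hA.apply hY)).sub (hA.apply (hD.isSmoothField_nabla hX hY))

/-- The Ricci identity for (1,1)-tensor fields. -/
theorem nablaNablaEndo_sub_swap (hD : IsLeviCivita D) (hA : IsSmoothEndo A)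
    (hW : IsSmoothField W) (hX : IsSmoothField X) (hY : IsSmoothField Y) (x : M) :
    nablaNablaEndo D W X A Y x - nablaNablaEndo D X W A Y x =
      curvature D W X (fun y ↦ A y (Y y)) x - A x (curvature D W X Y x) := by
  have n {X Y : Π x : M, TangentSpace I x} (hX : IsSmoothField X) (hY : IsSmoothField Y) :=
    hD.isSmoothField_nabla hX hY
  rw [hD.curvature_eq hW hX, hD.curvature_eq hW hX]
  simp only [nablaNablaEndo]
  rw [nablaEndo_eq_sub (X := X) (Y := Y), nablaEndo_eq_sub (X := W) (Y := Y),
    nabla_sub (n hX (hA.apply hY)) (hA.apply (n hX hY)),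
    nabla_sub (n hW (hA.apply hY)) (hA.apply (n hW hY))]
  simp only [nablaEndo, Pi.sub_apply, map_sub]
  abel

variable [T2Space M]

theorem inner_nablaNablaEndo_of_skew (hD : IsLeviCivita D) (hA : IsSmoothEndo A)
    (hs : ∀ (x : M) (u v : TangentSpace I x), (inner ℝ (A x u) v : ℝ) = -inner ℝ u (A x v))
    (hW : IsSmoothField W) (hX : IsSmoothField X) (hY : IsSmoothField Y) (hZ : IsSmoothField Z)
    (x : M) : (inner ℝ (nablaNablaEndo D W X A Y x) (Z x) : ℝ) =
      -inner ℝ (nablaNablaEndo D W X A Z x) (Y x) := by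
  have n {X Y : Π x : M, TangentSpace I x} (hX : IsSmoothField X) (hY : IsSmoothField Y) :=
    hD.isSmoothField_nabla hX hY
  have s {X Y Z : Π x : M, TangentSpace I x} (hY : IsSmoothField Y) (hZ : IsSmoothField Z)
      (x : M) := hD.inner_nablaEndo_of_skew (X := X) hA hs hY hZ x
  have h1 := hD.mvfderiv_inner (X := W) (hD.isSmoothField_nablaEndo hA hX hY) hZ x
  have h2 := hD.mvfderiv_inner (X := W) hY (hD.isSmoothField_nablaEndo hA hX hZ) x
  have e : (fun y ↦ (inner ℝ (nablaEndo D X A Y y) (Z y) : ℝ)) =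
      -fun y ↦ inner ℝ (Y y) (nablaEndo D X A Z y) := by
    ext y
    exact s hY hZ y
  rw [e, mvfderiv_neg] at h1
  simp only [_root_.neg_apply] at h1
  rw [h2] at h1
  rw [real_inner_comm (Y x) (nablaNablaEndo D W X A Z x)]
  simp only [nablaNablaEndo, inner_sub_left, inner_sub_right, s hY (n hW hZ), s hY hZ,
    s (n hW hY) hZ] at h1 ⊢
  linarith

/-- The Killing identity `R_{ξ,X} Y = -(∇_X ∇ξ) Y`. -/
theorem curvature_of_killing (hD : IsLeviCivita D) {ξ : Π x : M, TangentSpace I x}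
    (hξ : IsSmoothField ξ)
    (hs : ∀ (x : M) (u v : TangentSpace I x), (inner ℝ (D ξ x u) v : ℝ) = -inner ℝ u (D ξ x v))
    (hX : IsSmoothField X) (hY : IsSmoothField Y) (x : M) :
    curvature D ξ X Y x = -nablaEndo D X (D ξ) Y x ∧
    ∀ Z, IsSmoothField Z →
      (inner ℝ (nablaEndo D X (D ξ) Y x) (Z x) : ℝ) + inner ℝ (nablaEndo D Y (D ξ) Z x) (X x)
        + inner ℝ (nablaEndo D Z (D ξ) X x) (Y x) = 0 := by
  have a {X Y : Π x : M, TangentSpace I x} (hX : IsSmoothField X) (hY : IsSmoothField Y) :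
      curvature D X Y ξ x = nablaEndo D X (D ξ) Y x - nablaEndo D Y (D ξ) X x := by
    rw [hD.curvature_eq hX hY]
    simp only [nablaEndo]
    change nabla D X (nabla D Y ξ) x - nabla D Y (nabla D X ξ) x -
      (nabla D (nabla D X Y) ξ x - nabla D (nabla D Y X) ξ x) =
      nabla D X (nabla D Y ξ) x - nabla D (nabla D X Y) ξ x -
      (nabla D Y (nabla D X ξ) x - nabla D (nabla D Y X) ξ x)
    abel
  have s {X Y Z : Π x : M, TangentSpace I x} (hY : IsSmoothField Y) (hZ : IsSmoothField Z) :
      (inner ℝ (nablaEndo D X (D ξ) Y x) (Z x) : ℝ) =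
        -inner ℝ (nablaEndo D X (D ξ) Z x) (Y x) := by
    rw [hD.inner_nablaEndo_of_skew (hD.isSmoothEndo hξ) hs hY hZ x, real_inner_comm]
  -- By `a`, R_{X,Y}ξ is an alternation of ∇∇ξ; pairing the Bianchi identity with ξ gives twice this
  -- cyclic sum, up to sign.
  have cyc Z (hZ : IsSmoothField Z) :
      (inner ℝ (nablaEndo D X (D ξ) Y x) (Z x) : ℝ) + inner ℝ (nablaEndo D Y (D ξ) Z x) (X x)
        + inner ℝ (nablaEndo D Z (D ξ) X x) (Y x) = 0 := by
    have b := congrArg (fun v ↦ (inner ℝ v (ξ x) : ℝ)) (hD.bianchi hX hY hZ x)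
    simp only [inner_add_left, inner_zero_left, hD.inner_curvature_swap hX hY hZ hξ,
      hD.inner_curvature_swap hY hZ hX hξ, hD.inner_curvature_swap hZ hX hY hξ,
      a hX hY, a hY hZ, a hZ hX, inner_sub_left] at b
    linarith [s (X := X) hY hZ, s (X := Y) hZ hX, s (X := Z) hX hY]
  refine ⟨?_, cyc⟩
  refine ext_inner_right ℝ fun v ↦ ?_
  obtain ⟨Z, hZ, rfl⟩ := exists_isSmoothField_apply_eq v
  rw [hD.inner_curvature_pair_symm hξ hX hY hZ, a hY hZ, inner_sub_left, inner_neg_left]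
  linarith [cyc Z hZ, s (X := Z) hX hY]

end IsLeviCivita

namespace IsWeakNearlySasakian

variable [T2Space M] {φ Q : Π x : M, TangentSpace I x →L[ℝ] TangentSpace I x}
  {ξ : Π x : M, TangentSpace I x} {η : Π x : M, TangentSpace I x →L[ℝ] ℝ}

/-- Differentiate the nearly Sasakian identity along `W`, with η written as g(ξ, ·). The same
identity for ∇_W X and ∇_W Y absorbs their terms, leaving only derivatives of ξ. -/
theorem nablaNablaEndo_φ_add_swap (hD : IsLeviCivita D) (hS : IsWeakNearlySasakian D φ Q ξ η)
    (hW : IsSmoothField W) (hX : IsSmoothField X) (hY : IsSmoothField Y) (x : M) :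
    nablaNablaEndo D W X φ Y x + nablaNablaEndo D W Y φ X x =
      (2 * inner ℝ (X x) (Y x) : ℝ) • D ξ x (W x) - (inner ℝ (D ξ x (W x)) (X x) : ℝ) • Y x
        - (inner ℝ (D ξ x (W x)) (Y x) : ℝ) • X x := by
  have n {X Y : Π x : M, TangentSpace I x} (hX : IsSmoothField X) (hY : IsSmoothField Y) :=
    hD.isSmoothField_nabla hX hY
  have e : nablaEndo D X φ Y + nablaEndo D Y φ X =
      (fun y ↦ (inner ℝ (X y) (Y y) : ℝ)) • ξ + (fun y ↦ (inner ℝ (X y) (Y y) : ℝ)) • ξ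
        - (fun y ↦ (inner ℝ (ξ y) (Y y) : ℝ)) • X - (fun y ↦ (inner ℝ (ξ y) (X y) : ℝ)) • Y := by
    ext y
    simp only [Pi.add_apply, Pi.sub_apply, Pi.smul_apply', hS.nearly X Y hX hY, hS.η_eq_inner]
    module
  have sξ := hS.smooth_ξ.smul (hX.inner hY)
  have sX := hX.smul (hS.smooth_ξ.inner hY)
  have sY := hY.smul (hS.smooth_ξ.inner hX)
  have h := congrFun (congrArg (nabla D W) e) x
  rw [nabla_add (hD.isSmoothField_nablaEndo hS.smooth_φ hX hY)
    (hD.isSmoothField_nablaEndo hS.smooth_φ hY hX), nabla_sub ((sξ.add sξ).sub sX) sY,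
    nabla_sub (sξ.add sξ) sX, nabla_add sξ sξ] at h
  simp only [Pi.add_apply, Pi.sub_apply, nabla_smul (hX.inner hY) hS.smooth_ξ,
    nabla_smul (hS.smooth_ξ.inner hY) hX, nabla_smul (hS.smooth_ξ.inner hX) hY,
    hD.mvfderiv_inner hX hY, hD.mvfderiv_inner hS.smooth_ξ hX,
    hD.mvfderiv_inner hS.smooth_ξ hY] at h
  have h1 := hS.nearly (nabla D W X) Y (n hW hX) hY x
  have h2 := hS.nearly X (nabla D W Y) hX (n hW hY) x
  rw [hS.η_eq_inner, hS.η_eq_inner] at h1 h2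
  simp only [nablaNablaEndo]
  rw [← sub_eq_zero] at h h1 h2 ⊢
  have : (0 : TangentSpace I x) = 0 - 0 - 0 := by simp
  rw [this]
  nth_rw 1 [← h]
  nth_rw 1 [← h1]
  rw [← h2]
  simp only [nabla]
  module

/-- The curvature tensor is annihilated by the derivation induced by `φ`. -/
theorem curvature_φ_derivation (hD : IsLeviCivita D) (hS : IsWeakNearlySasakian D φ Q ξ η)
    (hQ : ∀ Y : Π x : M, TangentSpace I x, IsSmoothField Y → ∀ x, nablaEndo D ξ Q Y x = 0)
    (hW : IsSmoothField W) (hX : IsSmoothField X) (hY : IsSmoothField Y) (hZ : IsSmoothField Z)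
    (x : M) :
    (inner ℝ (curvature D (fun y ↦ φ y (W y)) X Y x) (Z x) : ℝ)
      + inner ℝ (curvature D W (fun y ↦ φ y (X y)) Y x) (Z x)
      + inner ℝ (curvature D W X (fun y ↦ φ y (Y y)) x) (Z x)
      + inner ℝ (curvature D W X Y x) (φ x (Z x)) = 0 := by
  refine curvature_derivation_eq_zero (α := {X : Π x : M, TangentSpace I x // IsSmoothField X})
    (f := fun X ↦ ⟨fun y ↦ φ y (X.1 y), hS.smooth_φ.apply X.2⟩)
    (R := fun W X Y Z ↦ inner ℝ (curvature D W.1 X.1 Y.1 x) (Z.1 x))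
    (T := fun W X Y Z ↦ inner ℝ (nablaNablaEndo D W.1 X.1 φ Y.1 x) (Z.1 x))
    (g := fun X Y ↦ inner ℝ (X.1 x) (Y.1 x)) (a := fun X Y ↦ inner ℝ (D ξ x (X.1 x)) (Y.1 x))
    ?_ ?_ ?_ ?_ ?_ ?_ ?_ ⟨W, hW⟩ ⟨X, hX⟩ ⟨Y, hY⟩ ⟨Z, hZ⟩
  · exact fun X Y ↦ real_inner_comm _ _
  · intro X Y
    rw [hS.inner_D_ξ hD hQ, real_inner_comm]
  · exact fun W X Y Z ↦ hD.inner_curvature_pair_symm W.2 X.2 Y.2 Z.2 x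
  · intro W X Y Z
    rw [← inner_add_left, ← inner_add_left, hD.bianchi W.2 X.2 Y.2, inner_zero_left]
  · intro W X Y Z
    rw [← inner_sub_left, hD.nablaNablaEndo_sub_swap hS.smooth_φ W.2 X.2 Y.2, inner_sub_left,
      hS.inner_φ]
    ring
  · exact fun W X Y Z ↦ hD.inner_nablaNablaEndo_of_skew hS.smooth_φ hS.inner_φ W.2 X.2 Y.2 Z.2 x
  · intro W X Y Z
    rw [← inner_add_left, hS.nablaNablaEndo_φ_add_swap hD W.2 X.2 Y.2]
    simp only [inner_sub_left, inner_smul_left]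
    simp

end IsWeakNearlySasakian

end SecondDerivative

/-! ### The formula for ∇∇ξ. -/

section NablaXi

variable {E : Type*} [NormedAddCommGroup E] [NormedSpace ℝ E]
  {H : Type*} [TopologicalSpace H] {I : ModelWithCorners ℝ E H}
  {M : Type*} [TopologicalSpace M] [ChartedSpace H M] [IsManifold I ∞ M]
  [FiniteDimensional ℝ E] [RiemannianBundle (fun x : M ↦ TangentSpace I x)]
  [IsContMDiffRiemannianBundle I ∞ E (fun x : M ↦ TangentSpace I x)]
  {D : CovariantDerivative I E (TangentSpace I : M → Type _)}
  {X Y : Π x : M, TangentSpace I x}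
  {φ Q : Π x : M, TangentSpace I x →L[ℝ] TangentSpace I x}
  {ξ : Π x : M, TangentSpace I x} {η : Π x : M, TangentSpace I x →L[ℝ] ℝ} [T2Space M]

/-- The trilinear form g((∇_u ∇ξ)v, w) vanishes on ker η by `eq_zero_of_derivation_eq_zero`, so only
its ξ-components survive. -/
theorem IsWeakNearlySasakian.nablaEndo_D_ξ (hD : IsLeviCivita D)
    (hS : IsWeakNearlySasakian D φ Q ξ η)
    (hQ : ∀ Y : Π x : M, TangentSpace I x, IsSmoothField Y → ∀ x, nablaEndo D ξ Q Y x = 0)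
    (hR : ∀ X Y Z : Π x : M, TangentSpace I x,
      IsSmoothField X → IsSmoothField Y → IsSmoothField Z →
      ∀ x, η x (Y x) = 0 → η x (Z x) = 0 →
        η x (curvature D (fun y ↦ tildeQ Q y (X y)) Y Z x) = 0)
    {x : M}
    (hY : MDifferentiableAt I (I.prod 𝓘(ℝ, E)) (fun y ↦ TotalSpace.mk' E y (Y y)) x) :
    nablaEndo D X (D ξ) Y x = (inner ℝ (D ξ x (D ξ x (X x))) (Y x) : ℝ) • ξ x
      - η x (Y x) • D ξ x (D ξ x (X x)) := by
  have hs := hS.inner_D_ξ hD hQ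
  have hA : IsSmoothEndo (D ξ) := hD.isSmoothEndo hS.smooth_ξ
  obtain ⟨Y', hY', hYY'⟩ := exists_isSmoothField_apply_eq (Y x)
  rw [hA.nablaEndo_congr hY (hY'.mdifferentiableAt x) hYY'.symm, ← hYY']
  -- A chosen extension of each vector makes `c` a function on tangent vectors; by tensoriality the
  -- choice is immaterial.
  choose e he hex using fun v : TangentSpace I x ↦ exists_isSmoothField_apply_eq v
  obtain ⟨c, hc'⟩ : ∃ c : TangentSpace I x → TangentSpace I x → TangentSpace I x → ℝ,
      ∀ u v w, c u v w = inner ℝ (nablaEndo D (e u) (D ξ) (e v) x) w := ⟨_, fun _ _ _ ↦ rfl⟩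
  have hc {X Y : Π x : M, TangentSpace I x} (hY : IsSmoothField Y) (w : TangentSpace I x) :
      (inner ℝ (nablaEndo D X (D ξ) Y x) w : ℝ) = c (X x) (Y x) w := by
    rw [hc', nablaEndo_congr_left (X' := e (X x)) (hex _).symm,
      hA.nablaEndo_congr (hY.mdifferentiableAt x) ((he _).mdifferentiableAt x) (hex _).symm]
  have skew u v w : c u v w = -c u w v := by
    have := hD.inner_nablaEndo_of_skew (X := e u) hA hs (he v) (he w) x
    rw [hc (he v), real_inner_comm (nablaEndo D (e u) (D ξ) (e w) x), hc (he w)] at this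
    simpa only [hex] using this
  have sub3 u v w w' (a : ℝ) : c u v (w - a • w') = c u v w - a * c u v w' := by
    rw [hc', inner_sub_right, inner_smul_right, ← hc', ← hc']
  have sub2 u v v' w (a : ℝ) : c u (v - a • v') w = c u v w - a * c u v' w := by
    rw [skew, sub3, skew u v, skew u v']
    ring
  have sub1 u u' v w (a : ℝ) : c (u - a • u') v w = c u v w - a * c u' v w := by
    rw [hc', hc', hc']
    simp only [nablaEndo, nabla, hex, map_sub, map_smul, inner_sub_left, inner_smul_left]
    simp
    ring
  have curv u v w (hv : IsSmoothField v) (hu : IsSmoothField u) :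
      (inner ℝ (curvature D ξ u v x) w : ℝ) = -c (u x) (v x) w := by
    rw [(hD.curvature_of_killing hS.smooth_ξ hs hu hv x).1, inner_neg_left, hc hv]
  have cyc u v w : c u v w + c v w u + c w u v = 0 := by
    have := (hD.curvature_of_killing hS.smooth_ξ hs (he u) (he v) x).2 (e w) (he w)
    rw [hc (he v), hc (he w), hc (he u)] at this
    simpa only [hex] using this
  have c1 v w : c (ξ x) v w = 0 := by
    have h1 := curv ξ (e v) w (he v) hS.smooth_ξ
    have h2 : curvature D ξ ξ (e v) x = 0 := by
      have h := hD.curvature_swap (Z := e v) hS.smooth_ξ hS.smooth_ξ x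
      rwa [← sub_eq_zero, sub_neg_eq_add, ← two_smul ℝ, smul_eq_zero_iff_right two_ne_zero] at h
    rw [h2, inner_zero_left, hex] at h1
    linarith
  have c2 u w : c u (ξ x) w = -inner ℝ (D ξ x (D ξ x u)) w := by
    have h := hc (X := e u) hS.smooth_ξ w
    have h0 : (fun y ↦ D ξ y (ξ y)) = 0 := by ext y; exact hS.D_ξ_ξ hD y
    rw [hex] at h
    rw [← h]
    unfold nablaEndo
    rw [h0]
    simp [nabla, D.zero, hex]
  have c3 u v : c u v (ξ x) = inner ℝ (D ξ x (D ξ x u)) v := by rw [skew, c2, neg_neg]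
  have der u v w : c (φ x u) v w + c u (φ x v) w + c u v (φ x w) = 0 := by
    have h := hS.curvature_φ_derivation hD hQ hS.smooth_ξ (he u) (he v) (he w) x
    have h0 : (fun y ↦ φ y (ξ y)) = 0 := by ext y; exact hS.φ_ξ y
    have h1 : curvature D (fun y ↦ φ y (ξ y)) (e u) (e v) x = 0 := by
      rw [h0]
      have : nabla D 0 (e v) = 0 := by ext y; simp [nabla]
      simp [curvature, nabla, D.zero, this]
    rw [h1, inner_zero_left, curv _ _ _ (he v) (hS.smooth_φ.apply (he u)),
      curv _ _ _ (hS.smooth_φ.apply (he v)) (he u), curv _ _ _ (he v) (he u)] at h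
    simp only [hex] at h
    linarith
  -- Pair symmetry moves ξ into the curvature operator in `hR`, where the Killing identity turns it
  -- into `c`.
  have tq u v w (hu : η x u = 0) (hw : η x w = 0) : c u (tildeQ Q x v) w = 0 := by
    have sQ : IsSmoothField (fun y ↦ tildeQ Q y (e v y)) :=
      (hS.smooth_Q.apply (he v)).sub (he v)
    have h := hR (e v) (e w) (e u) (he v) (he w) (he u) x (by rwa [hex]) (by rwa [hex])
    rw [hS.η_eq_inner, real_inner_comm,
      hD.inner_curvature_pair_symm sQ (he w) (he u) hS.smooth_ξ,
      hD.curvature_swap (he u) hS.smooth_ξ, inner_neg_left, curv _ _ _ sQ (he u)] at h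
    simpa only [hex, neg_neg] using h
  have sq v (hv : η x v = 0) : φ x (φ x v) = -v - (1 : ℝ) • tildeQ Q x v := by
    rw [hS.sq_φ, hv]
    simp only [tildeQ, zero_smul, add_zero, one_smul, _root_.sub_apply,
      ContinuousLinearMap.id_apply]
    abel
  have neg3 u v w : c u v (-w) = -c u v w := by rw [hc', hc', inner_neg_right]
  have h3 u v w (hu : η x u = 0) (hv : η x v = 0) (hw : η x w = 0) :
      c u v (φ x (φ x w)) = -c u v w := by
    rw [sq w hw, sub3, skew u v (tildeQ Q x w), tq u w v hu hv, neg3]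
    ring
  have h2 u v w (hu : η x u = 0) (hv : η x v = 0) (hw : η x w = 0) :
      c u (φ x (φ x v)) w = -c u v w := by
    rw [skew, h3 u w v hu hw hv, ← skew]
  -- The cyclic identity transfers the rule from the last two slots to the first.
  have h1 u v w (hu : η x u = 0) (hv : η x v = 0) (hw : η x w = 0) :
      c (φ x (φ x u)) v w = -c u v w := by
    linarith [cyc (φ x (φ x u)) v w, cyc u v w, h3 v w u hv hw hu, h2 w u v hw hu hv]
  refine ext_inner_right ℝ fun w ↦ ?_
  have key := eq_zero_of_derivation_eq_zero (p := fun u ↦ η x u = 0) (f := φ x) (c := c)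
    (fun u _ ↦ hS.η_φ x u) (fun u v w _ _ _ ↦ der u v w) h1 h2 h3
    (x := X x - η x (X x) • ξ x) (y := Y' x - η x (Y' x) • ξ x) (z := w - η x w • ξ x)
    (by simp [hS.η_ξ]) (by simp [hS.η_ξ]) (by simp [hS.η_ξ])
  have c4 u : c u (ξ x) (ξ x) = 0 := by linarith [skew u (ξ x) (ξ x)]
  rw [sub1, sub2, sub3, sub3, c1, c4, c3, c2] at key
  rw [hc hY', inner_sub_left, inner_smul_left, inner_smul_left, ← hS.η_eq_inner]
  simp only [conj_trivial]
  linarith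

end NablaXi

/-! ### Locally constant functions and derivatives of traces. -/

section Trace

variable {E : Type*} [NormedAddCommGroup E] [NormedSpace ℝ E]
  {H : Type*} [TopologicalSpace H] {I : ModelWithCorners ℝ E H}
  {M : Type*} [TopologicalSpace M] [ChartedSpace H M] [IsManifold I ∞ M]
  [FiniteDimensional ℝ E] {D : CovariantDerivative I E (TangentSpace I : M → Type _)}

theorem mvfderiv_congr {f g : M → ℝ} {x : M} (h : f =ᶠ[nhds x] g) (v : TangentSpace I x) :
    mvfderiv I f x v = mvfderiv I g x v :=
  congrArg (fun L : E →L[ℝ] ℝ ↦ L v) h.mfderiv_eq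

theorem mvfderiv_sum {ι : Type*} [Fintype ι] {f : ι → M → ℝ} {x : M}
    (h : ∀ i, MDifferentiableAt I 𝓘(ℝ, ℝ) (f i) x) (v : TangentSpace I x) :
    mvfderiv I (fun y ↦ ∑ i, f i y) x v = ∑ i, mvfderiv I (f i) x v := by
  classical
  have key (s : Finset ι) : MDifferentiableAt I 𝓘(ℝ, ℝ) (fun y ↦ ∑ i ∈ s, f i y) x ∧
      mvfderiv I (fun y ↦ ∑ i ∈ s, f i y) x v = ∑ i ∈ s, mvfderiv I (f i) x v := by
    induction s using Finset.induction_on with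
    | empty =>
      simp only [Finset.sum_empty]
      exact ⟨mdifferentiableAt_const, by rw [mvfderiv_const]; rfl⟩
    | insert a s ha ih =>
      simp only [Finset.sum_insert ha]
      refine ⟨(h a).add ih.1, ?_⟩
      rw [← ih.2]
      exact congrArg (fun L ↦ L v) (mvfderiv_add (h a) ih.1)
  exact (key Finset.univ).2

/-- A smooth function with vanishing derivative is locally constant. -/
theorem isLocallyConstant_of_mvfderiv_eq_zero [I.Boundaryless] {f : M → ℝ}
    (hf : ContMDiff I 𝓘(ℝ, ℝ) ∞ f) (h : ∀ x, mvfderiv I f x = 0) : IsLocallyConstant f := by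
  rw [IsLocallyConstant.iff_eventually_eq]
  intro x
  set e := extChartAt I x with he
  -- Without boundary the chart target is open, so a zero derivative makes the level sets in it
  -- open.
  have hs : IsOpen e.target := isOpen_extChartAt_target x
  have hd (z : E) (hz : z ∈ e.target) : HasFDerivAt (f ∘ e.symm) (0 : E →L[ℝ] ℝ) z := by
    have h1 : HasMFDerivAt I 𝓘(ℝ, ℝ) f (e.symm z) (0 : E →L[ℝ] ℝ) := by
      have h2 := (hf.contMDiffAt (x := e.symm z)).mdifferentiableAt (by simp) |>.hasMFDerivAt
      have h3 : mfderiv I 𝓘(ℝ, ℝ) f (e.symm z) = (0 : E →L[ℝ] ℝ) := by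
        ext v
        exact congrArg (fun L ↦ L v) (h (e.symm z))
      rwa [h3] at h2
    have h2 : MDifferentiableAt 𝓘(ℝ, E) I e.symm z :=
      ((contMDiffOn_extChartAt_symm (n := ∞) x).contMDiffAt (hs.mem_nhds hz)).mdifferentiableAt
        (by simp)
    have h3 := h1.comp z h2.hasMFDerivAt
    exact (hasMFDerivAt_iff_hasFDerivAt.1 h3).congr_fderiv (by ext v; rfl)
  have ho := hs.isOpen_inter_preimage_of_fderiv_eq_zero
    (f := f ∘ e.symm) (fun z hz ↦ (hd z hz).differentiableAt.differentiableWithinAt)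
    (fun z hz ↦ (hd z hz).fderiv) {f x}
  have hx : e x ∈ e.target := mem_extChartAt_target x
  have hmem : e.target ∩ (f ∘ e.symm) ⁻¹' {f x} ∈ nhds (e x) :=
    ho.mem_nhds ⟨hx, by simp [he]⟩
  filter_upwards [(continuousAt_extChartAt (I := I) x).preimage_mem_nhds hmem,
    extChartAt_source_mem_nhds (I := I) x] with y hy hys
  have h5 : f (e.symm (e y)) = f x := hy.2
  rwa [e.left_inv hys] at h5

/-- The trace of a (1,1)-tensor field which preserves smoothness of local sections is smooth, and
its derivative is the trace of the covariant derivative. -/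
theorem contMDiffAt_trEndo_and_mvfderiv_eq
    {A : Π x : M, TangentSpace I x →L[ℝ] TangentSpace I x} (x : M)
    (hA : ∀ Y : Π x : M, TangentSpace I x,
      ContMDiffAt I (I.prod 𝓘(ℝ, E)) ∞ (fun y ↦ TotalSpace.mk' E y (Y y)) x →
      ContMDiffAt I (I.prod 𝓘(ℝ, E)) ∞ (fun y ↦ TotalSpace.mk' E y (A y (Y y))) x) :
    ContMDiffAt I 𝓘(ℝ, ℝ) ∞ (fun y ↦ trEndo (A y)) x ∧
    ∀ (X : Π x : M, TangentSpace I x) (B : TangentSpace I x →ₗ[ℝ] TangentSpace I x),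
      (∀ Y : Π x : M, TangentSpace I x,
        ContMDiffAt I (I.prod 𝓘(ℝ, E)) ∞ (fun y ↦ TotalSpace.mk' E y (Y y)) x →
        nablaEndo D X A Y x = B (Y x)) →
      mvfderiv I (fun y ↦ trEndo (A y)) x (X x) =
        LinearMap.trace ℝ (TangentSpace I x) B := by
  set t := trivializationAt E (TangentSpace I : M → Type _) x
  have hx : x ∈ t.baseSet := FiberBundle.mem_baseSet_trivializationAt E _ x
  let b := Module.finBasis ℝ E
  let s := t.localFrame b
  let co := t.localFrameCoeff I b
  have hs i : ContMDiffAt I (I.prod 𝓘(ℝ, E)) ∞ (fun y ↦ TotalSpace.mk' E y (s i y)) x :=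
    contMDiffAt_localFrame_of_mem ∞ t b i hx
  have hAs i : ContMDiffAt I (I.prod 𝓘(ℝ, E)) ∞ (fun y ↦ TotalSpace.mk' E y (A y (s i y))) x :=
    hA _ (hs i)
  have hco i j : ContMDiffAt I 𝓘(ℝ, ℝ) ∞ (fun y ↦ co j y (A y (s i y))) x :=
    contMDiffAt_localFrameCoeff b hx (hAs i) j
  have tr_eq {y : M} (hy : y ∈ t.baseSet) (L : TangentSpace I y →ₗ[ℝ] TangentSpace I y) :
      LinearMap.trace ℝ (TangentSpace I y) L = ∑ i, co i y (L (s i y)) := by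
    rw [LinearMap.trace_eq_matrix_trace ℝ (t.basisAt b hy), Matrix.trace]
    refine Finset.sum_congr rfl fun i _ ↦ ?_
    have e1 := t.localFrameCoeff_apply_of_mem_baseSet (I := I) b hy
      (FiberBundle.extend E (L (s i y))) i
    rw [FiberBundle.extend_apply_self] at e1
    rw [Matrix.diag_apply, LinearMap.toMatrix_apply, ← t.localFrame_apply_of_mem_baseSet b hy]
    exact e1.symm
  have ev : (fun y ↦ trEndo (A y)) =ᶠ[nhds x] fun y ↦ ∑ i, co i y (A y (s i y)) :=
    Filter.eventuallyEq_of_mem (t.open_baseSet.mem_nhds hx) fun y hy ↦ tr_eq hy _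
  have sm : ContMDiffAt I 𝓘(ℝ, ℝ) ∞ (fun y ↦ ∑ i, co i y (A y (s i y))) x :=
    ContMDiffAt.sum fun i _ ↦ hco i i
  refine ⟨sm.congr_of_eventuallyEq ev, fun X B hB ↦ ?_⟩
  have co_s {y : M} (hy : y ∈ t.baseSet) (i j) : co i y (s j y) = if j = i then 1 else 0 := by
    rw [t.localFrameCoeff_apply_of_mem_baseSet (I := I) b hy (s j) i,
      show s j y = t.basisAt b hy j from t.localFrame_apply_of_mem_baseSet b hy, Module.Basis.repr_self, Finsupp.single_apply]
  have dco {σ : Π y : M, TangentSpace I y}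
      (hσ : MDifferentiableAt I (I.prod 𝓘(ℝ, E)) (fun y ↦ TotalSpace.mk' E y (σ y)) x) (j) :
      MDifferentiableAt I 𝓘(ℝ, ℝ) (fun y ↦ co j y (σ y)) x :=
    mdifferentiableAt_localFrameCoeff b hx hσ j
  -- The connection minus the coefficientwise derivative in the frame is tensorial; `N` below is the
  -- connection matrix in direction `X x`.
  have hΦ : TensorialAt I E (fun σ : Π y : M, TangentSpace I y ↦ D σ x (X x) -
      ∑ j, mvfderiv I (fun y ↦ co j y (σ y)) x (X x) • s j x) x := by
    refine ⟨fun {f σ} hf hσ ↦ ?_, fun {σ σ'} hσ hσ' ↦ ?_⟩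
    · have e1 j : (fun y ↦ co j y ((f • σ) y)) = f • fun y ↦ co j y (σ y) := by
        ext y
        simp
      have e2 : σ x = ∑ j, co j x (σ x) • s j x :=
        t.eq_sum_localFrameCoeff_smul hx
      rw [D.isCovariantDerivativeOnUniv.leibniz hσ hf]
      simp only [e1, mvfderiv_smul hf (dco hσ _)]
      simp only [_root_.add_apply, _root_.smul_apply, ContinuousLinearMap.smulRight_apply,
        smul_sub, Finset.smul_sum, add_smul, Finset.sum_add_distrib, smul_assoc]
      nth_rw 1 [e2]
      simp only [Finset.smul_sum, smul_smul]
      abel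
    · have e1 j : (fun y ↦ co j y ((σ + σ') y)) =
          (fun y ↦ co j y (σ y)) + fun y ↦ co j y (σ' y) := by
        ext y
        simp
      rw [D.isCovariantDerivativeOnUniv.add hσ hσ']
      simp only [e1, mvfderiv_add (dco hσ _) (dco hσ' _)]
      simp only [_root_.add_apply, add_smul, Finset.sum_add_distrib]
      abel
  have hs' i := (hs i).mdifferentiableAt (by simp)
  have hAs' i := (hAs i).mdifferentiableAt (by simp)
  let N := TensorialAt.mkHom _ x hΦ
  have hN {σ : Π y : M, TangentSpace I y}
      (hσ : MDifferentiableAt I (I.prod 𝓘(ℝ, E)) (fun y ↦ TotalSpace.mk' E y (σ y)) x) :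
      D σ x (X x) = N (σ x) + ∑ j, mvfderiv I (fun y ↦ co j y (σ y)) x (X x) • s j x := by
    rw [TensorialAt.mkHom_apply hΦ hσ]
    abel
  have hNs i : D (s i) x (X x) = N (s i x) := by
    rw [hN (hs' i), add_eq_left]
    refine Finset.sum_eq_zero fun j _ ↦ ?_
    have : (fun y ↦ co j y (s i y)) =ᶠ[nhds x] fun _ ↦ if i = j then (1 : ℝ) else 0 :=
      Filter.eventuallyEq_of_mem (t.open_baseSet.mem_nhds hx) fun y hy ↦ co_s hy j i
    rw [mvfderiv_congr this, mvfderiv_const]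
    simp
  have h1 i : co i x (D (fun y ↦ A y (s i y)) x (X x)) =
      co i x (N (A x (s i x))) + mvfderiv I (fun y ↦ co i y (A y (s i y))) x (X x) := by
    rw [hN (hAs' i)]
    simp [co_s hx]
  have h2 i : co i x (D (fun y ↦ A y (s i y)) x (X x)) =
      co i x (B (s i x)) + co i x (A x (N (s i x))) := by
    rw [← hB _ (hs i), ← hNs, ← map_add]
    simp [nablaEndo, nabla]
  have h3 : mvfderiv I (fun y ↦ trEndo (A y)) x (X x) =
      ∑ i, mvfderiv I (fun y ↦ co i y (A y (s i y))) x (X x) := by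
    rw [mvfderiv_congr ev, mvfderiv_sum fun i ↦ dco (hAs' i) i]
  -- The connection matrix enters the trace of the covariant derivative only through the commutator
  -- [N, A], which is traceless.
  have h4 : trEndo (N ∘L A x) = trEndo (A x ∘L N) := LinearMap.trace_mul_comm ℝ _ _
  rw [h3, tr_eq hx]
  rw [trEndo, trEndo, tr_eq hx, tr_eq hx] at h4
  have h5 : ∑ i, (co i x (N (A x (s i x))) + mvfderiv I (fun y ↦ co i y (A y (s i y))) x (X x)) =
      ∑ i, (co i x (B (s i x)) + co i x (A x (N (s i x)))) :=
    Finset.sum_congr rfl fun i _ ↦ (h1 i).symm.trans (h2 i)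
  simp only [Finset.sum_add_distrib] at h5
  simp only [ContinuousLinearMap.coe_coe, ContinuousLinearMap.comp_apply] at h4 ⊢
  linarith

end Trace

/-! ### The Ricci curvature in direction ξ and the constancy of tr((∇ξ)²). -/

section Ricci

variable {E : Type*} [NormedAddCommGroup E] [NormedSpace ℝ E]
  {H : Type*} [TopologicalSpace H] {I : ModelWithCorners ℝ E H}
  {M : Type*} [TopologicalSpace M] [ChartedSpace H M] [IsManifold I ∞ M]
  [FiniteDimensional ℝ E] [RiemannianBundle (fun x : M ↦ TangentSpace I x)]
  [IsContMDiffRiemannianBundle I ∞ E (fun x : M ↦ TangentSpace I x)]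
  {D : CovariantDerivative I E (TangentSpace I : M → Type _)}
  {X Y Z : Π x : M, TangentSpace I x}
  {φ Q : Π x : M, TangentSpace I x →L[ℝ] TangentSpace I x}
  {ξ : Π x : M, TangentSpace I x} {η : Π x : M, TangentSpace I x →L[ℝ] ℝ} [T2Space M]

/-- `ricci` uses extensions smooth only near `x`; this replaces them by global smooth fields with
the same germ. -/
theorem IsLeviCivita.curvature_congr_left (hD : IsLeviCivita D)
    {X' : Π x : M, TangentSpace I x} (hX : IsSmoothField X)
    (hZ : IsSmoothField Z) {x : M} (h : ∀ᶠ y in nhds x, X y = X' y) :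
    curvature D X' Y Z x = curvature D X Y Z x := by
  have e1 : VectorField.mlieBracket I X' Y x = VectorField.mlieBracket I X Y x :=
    Filter.EventuallyEq.mlieBracket_vectorField_eq (h.mono fun _ hy ↦ hy.symm) .rfl
  have e2 : ∀ᶠ y in nhds x, nabla D X Z y = nabla D X' Z y :=
    h.mono fun y hy ↦ by simp [nabla, hy]
  have d1 := (hD.isSmoothField_nabla hX hZ).mdifferentiableAt x
  have d2 : MDifferentiableAt I (I.prod 𝓘(ℝ, E))
      (fun y ↦ TotalSpace.mk' E y (nabla D X' Z y)) x :=
    d1.congr_of_eventuallyEq (e2.mono fun y hy ↦ by simp [hy])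
  have e3 := D.isCovariantDerivativeOnUniv.congr_of_eventuallyEq d1 d2 Filter.univ_mem e2
  have e4 : nabla D Y (nabla D X' Z) x = nabla D Y (nabla D X Z) x := by
    simp only [nabla]
    exact congrArg (fun L ↦ L (Y x)) e3.symm
  rw [curvature, curvature, e4]
  simp only [nabla, e1, h.self_of_nhds]

namespace IsWeakNearlySasakian

theorem ricci_ξ (hD : IsLeviCivita D)
    (hS : IsWeakNearlySasakian D φ Q ξ η)
    (hQ : ∀ Y : Π x : M, TangentSpace I x, IsSmoothField Y → ∀ x, nablaEndo D ξ Q Y x = 0)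
    (hR : ∀ X Y Z : Π x : M, TangentSpace I x,
      IsSmoothField X → IsSmoothField Y → IsSmoothField Z →
      ∀ x, η x (Y x) = 0 → η x (Z x) = 0 →
        η x (curvature D (fun y ↦ tildeQ Q y (X y)) Y Z x) = 0)
    (hZ : IsSmoothField Z) (x : M) :
    ricci D ξ Z x = -(η x (Z x)) * trEndo (D ξ x ∘L D ξ x) := by
  have hs := hS.inner_D_ξ hD hQ
  have key (v : TangentSpace I x) :
      (inner ℝ (curvature D (FiberBundle.extend E v) ξ Z x) v : ℝ) =
        inner ℝ (D ξ x (D ξ x (Z x))) v * inner ℝ v (ξ x)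
          - η x (Z x) * inner ℝ v (D ξ x (D ξ x v)) := by
    obtain ⟨X, hX, hXv, hX'⟩ := exists_isSmoothField_eventuallyEq v
    rw [hD.curvature_congr_left hX hZ hX', hD.curvature_swap hX hS.smooth_ξ,
      (hD.curvature_of_killing hS.smooth_ξ hs hX hZ x).1, neg_neg,
      hS.nablaEndo_D_ξ hD hQ hR (hZ.mdifferentiableAt x), hXv, inner_sub_left, inner_smul_left,
      inner_smul_left, hs x (D ξ x v), hs x v, real_inner_comm (ξ x) v,
      real_inner_comm (D ξ x (D ξ x v)) v, real_inner_comm v (D ξ x (D ξ x (Z x)))]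
    simp
  have : FiniteDimensional ℝ (TangentSpace I x) := inferInstanceAs (FiniteDimensional ℝ E)
  simp only [ricci, key]
  generalize stdOrthonormalBasis ℝ (TangentSpace I x) = b
  -- Parseval sums the first terms to g((∇ξ)²Z, ξ) = −g(∇_Z ξ, ∇_ξ ξ) = 0; the others form the
  -- trace.
  rw [Finset.sum_sub_distrib, b.sum_inner_mul_inner, ← Finset.mul_sum, hs, hS.D_ξ_ξ hD,
    inner_zero_right, trEndo, LinearMap.trace_eq_sum_inner _ b]
  simp

/-- The scalar `tr (h² + Q̃)` in terms of `∇ξ`. -/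
theorem trEndo_tensorH_sq (hD : IsLeviCivita D)
    (hS : IsWeakNearlySasakian D φ Q ξ η)
    (hQ : ∀ Y : Π x : M, TangentSpace I x, IsSmoothField Y → ∀ x, nablaEndo D ξ Q Y x = 0)
    (x : M) :
    trEndo (tensorH D φ ξ x ∘L tensorH D φ ξ x + tildeQ Q x) =
      trEndo (D ξ x ∘L D ξ x) + (Module.finrank ℝ E - 1) := by
  have : FiniteDimensional ℝ (TangentSpace I x) := inferInstanceAs (FiniteDimensional ℝ E)
  -- In (∇ξ + φ)² the cross terms give 2(id − η ⊗ ξ), and φ² + Q̃ = η ⊗ ξ − id.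
  have e : ((tensorH D φ ξ x ∘L tensorH D φ ξ x + tildeQ Q x :
      TangentSpace I x →L[ℝ] TangentSpace I x) : TangentSpace I x →ₗ[ℝ] TangentSpace I x) =
      ((D ξ x ∘L D ξ x : TangentSpace I x →L[ℝ] TangentSpace I x) :
        TangentSpace I x →ₗ[ℝ] TangentSpace I x) + (LinearMap.id -
        (η x : TangentSpace I x →ₗ[ℝ] ℝ).smulRight (ξ x)) := by
    ext u
    simp [tensorH, tildeQ, hS.D_ξ_φ hD hQ, hS.sq_φ]
    module
  have h1 : LinearMap.trace ℝ (TangentSpace I x) (LinearMap.id -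
      (η x : TangentSpace I x →ₗ[ℝ] ℝ).smulRight (ξ x)) = Module.finrank ℝ E - 1 := by
    rw [map_sub, LinearMap.trace_id, LinearMap.trace_smulRight]
    change (Module.finrank ℝ E : ℝ) - η x (ξ x) = _
    rw [hS.η_ξ]
  unfold trEndo
  rw [e, map_add, h1]

theorem trEndo_D_ξ_sq_nonpos (hD : IsLeviCivita D)
    (hS : IsWeakNearlySasakian D φ Q ξ η)
    (hQ : ∀ Y : Π x : M, TangentSpace I x, IsSmoothField Y → ∀ x, nablaEndo D ξ Q Y x = 0)
    (x : M) : trEndo (D ξ x ∘L D ξ x) ≤ 0 := by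
  have : FiniteDimensional ℝ (TangentSpace I x) := inferInstanceAs (FiniteDimensional ℝ E)
  rw [trEndo, LinearMap.trace_eq_sum_inner _ (stdOrthonormalBasis ℝ (TangentSpace I x))]
  refine Finset.sum_nonpos fun i _ ↦ ?_
  have := hS.inner_D_ξ hD hQ x (stdOrthonormalBasis ℝ (TangentSpace I x) i)
    (D ξ x (stdOrthonormalBasis ℝ (TangentSpace I x) i))
  have h2 := real_inner_self_nonneg (x := D ξ x (stdOrthonormalBasis ℝ (TangentSpace I x) i))
  simp only [ContinuousLinearMap.coe_coe, ContinuousLinearMap.comp_apply]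
  linarith

theorem isLocallyConstant_trEndo_D_ξ_sq [I.Boundaryless] (hD : IsLeviCivita D)
    (hS : IsWeakNearlySasakian D φ Q ξ η)
    (hQ : ∀ Y : Π x : M, TangentSpace I x, IsSmoothField Y → ∀ x, nablaEndo D ξ Q Y x = 0)
    (hR : ∀ X Y Z : Π x : M, TangentSpace I x,
      IsSmoothField X → IsSmoothField Y → IsSmoothField Z →
      ∀ x, η x (Y x) = 0 → η x (Z x) = 0 →
        η x (curvature D (fun y ↦ tildeQ Q y (X y)) Y Z x) = 0) :
    IsLocallyConstant fun x ↦ trEndo (D ξ x ∘L D ξ x) := by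
  have hA : IsSmoothEndo (D ξ) := hD.isSmoothEndo hS.smooth_ξ
  have hs := hS.inner_D_ξ hD hQ
  have ap {x : M} {Y : Π x : M, TangentSpace I x}
      (hY : ContMDiffAt I (I.prod 𝓘(ℝ, E)) ∞ (fun y ↦ TotalSpace.mk' E y (Y y)) x) :
      ContMDiffAt I (I.prod 𝓘(ℝ, E)) ∞ (fun y ↦ TotalSpace.mk' E y (D ξ y (Y y))) x :=
    ContMDiffAt.clm_bundle_apply (F₁ := E) (F₂ := E) (E₁ := fun x : M ↦ TangentSpace I x)
      (E₂ := fun x : M ↦ TangentSpace I x) (b := fun x ↦ x) (ContMDiff.contMDiffAt hA) hY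
  have main (x : M) := contMDiffAt_trEndo_and_mvfderiv_eq (D := D)
    (A := fun y ↦ D ξ y ∘L D ξ y) x fun Y hY ↦ ap (ap hY)
  refine isLocallyConstant_of_mvfderiv_eq_zero (I := I) (fun x ↦ (main x).1) fun x ↦ ?_
  ext v
  obtain ⟨X, hX, rfl⟩ := exists_isSmoothField_apply_eq v
  -- This is ∇_X((∇ξ)²) by the Leibniz rule. Its two rank-one terms have traces g((∇ξ)²X, ∇_ξ ξ) and
  -- η((∇ξ)³X), both zero.
  let B : TangentSpace I x →ₗ[ℝ] TangentSpace I x :=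
    ((innerₗ (TangentSpace I x) (D ξ x (D ξ x (X x)))).comp
      (D ξ x : TangentSpace I x →ₗ[ℝ] TangentSpace I x)).smulRight (ξ x)
      - (η x : TangentSpace I x →ₗ[ℝ] ℝ).smulRight (D ξ x (D ξ x (D ξ x (X x))))
  have : FiniteDimensional ℝ (TangentSpace I x) := inferInstanceAs (FiniteDimensional ℝ E)
  rw [(main x).2 X B fun Y hY ↦ ?_]
  · simp only [B, map_sub, LinearMap.trace_smulRight]
    simp [hS.D_ξ_ξ hD, hS.η_D_ξ hD]
  · have h1 := hS.nablaEndo_D_ξ (X := X) hD hQ hR (hY.mdifferentiableAt (by simp))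
    have h2 := hS.nablaEndo_D_ξ (X := X) hD hQ hR ((ap hY).mdifferentiableAt (by simp))
    rw [hS.η_D_ξ hD, zero_smul, sub_zero] at h2
    have h3 := congrArg (D ξ x) h1
    rw [map_sub, map_smul, map_smul, hS.D_ξ_ξ hD] at h3
    unfold nablaEndo at h2 h3 ⊢
    rw [map_sub] at h3
    simp only [B, ContinuousLinearMap.comp_apply, LinearMap.sub_apply,
      LinearMap.smulRight_apply, LinearMap.comp_apply, innerₗ_apply_apply,
      ContinuousLinearMap.coe_coe]
    rw [← h2, ← sub_eq_zero] 
    rw [← sub_eq_zero] at h3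
    rw [← h3]
    module

end IsWeakNearlySasakian

end Ricci

/-! ### Assembly of the conclusions. -/

theorem lemma3p3 {n : ℕ} (hn : 1 ≤ n)
    {M : Type*} [TopologicalSpace M] [T2Space M]
    [ChartedSpace (EuclideanSpace ℝ (Fin (2 * n + 1))) M] [IsManifold (𝓡 (2 * n + 1)) ∞ M]
    [RiemannianBundle (fun x : M ↦ TangentSpace (𝓡 (2 * n + 1)) x)]
    [IsContMDiffRiemannianBundle (𝓡 (2 * n + 1)) ∞ (EuclideanSpace ℝ (Fin (2 * n + 1)))
      (fun x : M ↦ TangentSpace (𝓡 (2 * n + 1)) x)]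
    (D : CovariantDerivative (𝓡 (2 * n + 1)) (EuclideanSpace ℝ (Fin (2 * n + 1)))
      (TangentSpace (𝓡 (2 * n + 1)) : M → Type _))
    (hD : IsLeviCivita D)
    (φ Q : Π x : M, TangentSpace (𝓡 (2 * n + 1)) x →L[ℝ] TangentSpace (𝓡 (2 * n + 1)) x)
    (ξ : Π x : M, TangentSpace (𝓡 (2 * n + 1)) x)
    (η : Π x : M, TangentSpace (𝓡 (2 * n + 1)) x →L[ℝ] ℝ)
    (hS : IsWeakNearlySasakian D φ Q ξ η)
    (hQ : ∀ Y : Π x : M, TangentSpace (𝓡 (2 * n + 1)) x, IsSmoothField Y →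
      ∀ x, η x (Y x) = 0 → nablaEndo D ξ (tildeQ Q) Y x = 0)
    (hR : ∀ X Y Z : Π x : M, TangentSpace (𝓡 (2 * n + 1)) x,
      IsSmoothField X → IsSmoothField Y → IsSmoothField Z →
      ∀ x, η x (Y x) = 0 → η x (Z x) = 0 →
        η x (curvature D (fun y ↦ tildeQ Q y (X y)) Y Z x) = 0) :
    (∀ X Y : Π x : M, TangentSpace (𝓡 (2 * n + 1)) x, IsSmoothField X → IsSmoothField Y → ∀ x,
      curvature D ξ X Y x = -nablaEndo D X (fun y ↦ tensorH D φ ξ y - φ y) Y x) ∧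
    (∀ X Y : Π x : M, TangentSpace (𝓡 (2 * n + 1)) x, IsSmoothField X → IsSmoothField Y → ∀ x,
      nablaEndo D X (fun y ↦ tensorH D φ ξ y - φ y) Y x =
        (inner ℝ (((tensorH D φ ξ x - φ x) ∘L (tensorH D φ ξ x - φ x)) (X x)) (Y x) : ℝ) • ξ x
          - η x (Y x) • ((tensorH D φ ξ x - φ x) ∘L (tensorH D φ ξ x - φ x)) (X x)) ∧
    (∀ Z : Π x : M, TangentSpace (𝓡 (2 * n + 1)) x, IsSmoothField Z → ∀ x,
      ricci D ξ Z x =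
        -(η x (Z x)) * (trEndo (tensorH D φ ξ x ∘L tensorH D φ ξ x + tildeQ Q x) - 2 * n)) ∧
    (∀ x y : M, y ∈ connectedComponent x →
      trEndo (tensorH D φ ξ y ∘L tensorH D φ ξ y + tildeQ Q y) =
        trEndo (tensorH D φ ξ x ∘L tensorH D φ ξ x + tildeQ Q x)) ∧
    (∀ x y : M, y ∈ connectedComponent x → ricci D ξ ξ y = ricci D ξ ξ x) ∧
    (∀ x : M, 0 ≤ ricci D ξ ξ x) ∧
    (∀ X : Π x : M, TangentSpace (𝓡 (2 * n + 1)) x, IsSmoothField X → ∀ x,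
      nablaEndo D ξ (tensorH D φ ξ) X x = nablaEndo D ξ φ X x ∧
      nablaEndo D ξ φ X x = (φ x ∘L tensorH D φ ξ x + tildeQ Q x) (X x)) := by
  have hQ' : ∀ Y : Π x : M, TangentSpace (𝓡 (2 * n + 1)) x, IsSmoothField Y →
      ∀ x, nablaEndo D ξ Q Y x = 0 := fun Y hY x ↦ hS.nablaEndo_ξ_Q hD hQ hY x
  have hA : (fun y ↦ tensorH D φ ξ y - φ y) = D ξ := by
    ext1 y
    simp [tensorH]
  have hA' (y : M) : tensorH D φ ξ y - φ y = D ξ y := congrFun hA y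
  have htr (x : M) : trEndo (tensorH D φ ξ x ∘L tensorH D φ ξ x + tildeQ Q x) =
      trEndo (D ξ x ∘L D ξ x) + 2 * n := by
    rw [hS.trEndo_tensorH_sq hD hQ' x]
    simp
  have hric {Z : Π x : M, TangentSpace (𝓡 (2 * n + 1)) x} (hZ : IsSmoothField Z) (x : M) :=
    hS.ricci_ξ hD hQ' hR hZ x
  have hconst {x y : M} (h : y ∈ connectedComponent x) :
      trEndo (D ξ y ∘L D ξ y) = trEndo (D ξ x ∘L D ξ x) :=
    (hS.isLocallyConstant_trEndo_D_ξ_sq hD hQ' hR).apply_eq_of_isPreconnected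
      isPreconnected_connectedComponent h mem_connectedComponent
  refine ⟨fun X Y hX hY x ↦ ?_, fun X Y _ hY x ↦ ?_, fun Z hZ x ↦ ?_, fun x y h ↦ ?_,
    fun x y h ↦ ?_, fun x ↦ ?_, fun X hX x ↦ ⟨?_, ?_⟩⟩
  · rw [hA]
    exact (hD.curvature_of_killing hS.smooth_ξ (hS.inner_D_ξ hD hQ') hX hY x).1
  · rw [hA, hA']
    exact hS.nablaEndo_D_ξ hD hQ' hR (hY.mdifferentiableAt x)
  · rw [hric hZ, htr, add_sub_cancel_right]
  · rw [htr, htr, hconst h]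
  · rw [hric hS.smooth_ξ, hric hS.smooth_ξ, hS.η_ξ, hS.η_ξ, hconst h]
  · rw [hric hS.smooth_ξ, hS.η_ξ]
    linarith [hS.trEndo_D_ξ_sq_nonpos hD hQ' x]
  · have h := hS.nablaEndo_D_ξ (X := ξ) hD hQ' hR (hX.mdifferentiableAt x)
    rw [hS.D_ξ_ξ hD, map_zero, inner_zero_left, zero_smul, smul_zero, sub_zero] at h
    have e : (fun y ↦ tensorH D φ ξ y (X y)) =
        (fun y ↦ D ξ y (X y)) + fun y ↦ φ y (X y) := by
      ext1 y
      simp [tensorH]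
    unfold nablaEndo at h ⊢
    rw [e, nabla_add ((hD.isSmoothEndo hS.smooth_ξ).apply hX) (hS.smooth_φ.apply hX),
      Pi.add_apply, sub_eq_zero.1 h]
    simp [tensorH]
  · rw [hS.nablaEndo_ξ_φ hX]
    simp [tensorH, tildeQ, hS.sq_φ]
    abel
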